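/- Let $\mathbb N=\{1,2,\dots\}$ and $1\le p\le\infty$. A weight is a measurable $2\pi$-periodic function $\gamma:\mathbb R\to[0,\infty]$ which is positive a.e. and integrable over $\mathbb T=[-\pi,\pi]$; write $\gamma(J)=\int_J\gamma\,dx$. In the suprema below, $J$ runs over all intervals (arcs of the circle), that is, intervals in $\mathbb R$ of length $0<|J|\le 2\pi$. The class $A\mathfrak S^1_p$ consists of the weights $\gamma$ such that * for $1<p<\infty$: $\displaystyle [\gamma]_p:=\sup_J \frac{\gamma(J)}{|J|}\Big(\frac1{|J|}\int_J\gamma^{-1/(p-1)}dx\Big)^{p-1}<\infty$; * for $p=1$: $\displaystyle [\gamma]_1:=\sup_J \frac{\gamma(J)}{|J|}<\infty$ and there is a constant $c_\gamma>0$ with $\gamma\ge c_\gamma$ a.e.; * for $p=\infty$: $\gamma=1$ a.e. Let $L_{p,\gamma}$ be the space of $2\pi$-periodic measurable $f:\mathbb R\to\mathbb R$ with $\|f\|_{p,\gamma}<\infty$, where $\|f\|_{p,\gamma}=\big(\int_{\mathbb T}|f|^p\gamma\,dx\big)^{1/p}$ for $p<\infty$ and $\|f\|_{\infty,\gamma}=\operatorname{ess\,sup}_{\mathbb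 T}|f|$. For $v>0$ put $$\mathfrak T_vf(x)=\frac1v\int_x^{x+v}f(t)\,dt,\qquad \Omega_r(f,v)_{p,\gamma}=\big\|(I-\mathfrak T_v)^rf\big\|_{p,\gamma},\qquad E_n(f)_{p,\gamma}=\inf_{u\in\Pi_n}\|f-u\|_{p,\gamma},$$ where $I$ is the identity operator and $\Pi_n$ is the set of real trigonometric polynomials $a_0+\sum_{k=1}^n(a_k\cos kx+b_k\sin kx)$ of degree at most $n$. **Theorem (Jackson inequality).** Let $1\le p\le\infty$, $r\in\mathbb N$, $\gamma\in A\mathfrak S^1_p$ and $f\in L_{p,\gamma}$. Then $$E_n(f)_{p,\gamma}\le C\,\Omega_r\big(f,\tfrac1n\big)_{p,\gamma}\qquad\text{for all } n\in\mathbb N,$$ where $C>0$ depends only on $r$, $p$ and, if $1<p<\infty$, on an upper bound for $[\gamma]_p$, and, if $p=1$, on an upper bound for $[\gamma]_1$ and a lower bound $c_\gamma>0$ of $\gamma$. -/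

import Mathlib

open MeasureTheory Set
open scoped ENNReal NNReal

noncomputable section

namespace WeightedJackson

/-- An integrable `2π`-periodic weight: a measurable `[0,∞]`-valued function, positive a.e.
and integrable over a period. -/
structure IsWeight (γ : ℝ → ℝ≥0∞) : Prop where
  measurable : Measurable γ
  periodic : Function.Periodic γ (2 * Real.pi)
  pos : ∀ᵐ x, 0 < γ x
  integrable : ∫⁻ x in Ioc (-Real.pi) Real.pi, γ x < ∞

/-- `[γ]₁`: the supremum of `γ(J) / mes(J)` over the intervals (arcs) `J` of the circle, that is,
over the intervals `J = (a, b]` of length at most `2π`. -/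
def sOneConst (γ : ℝ → ℝ≥0∞) : ℝ≥0∞ :=
  ⨆ (a : ℝ) (b : ℝ) (_ : a < b) (_ : b ≤ a + 2 * Real.pi), (∫⁻ x in Ioc a b, γ x) / ENNReal.ofReal (b - a)

/-- The Muckenhoupt constant `[γ]ₚ`, `1 < p < ∞`: the supremum over the intervals (arcs) `J` of
the circle of `(γ(J) / mes(J)) * ((1 / mes(J)) * ∫_J γ ^ (-1 / (p - 1))) ^ (p - 1)`. -/
def muckenhouptConst (p : ℝ) (γ : ℝ → ℝ≥0∞) : ℝ≥0∞ :=
  ⨆ (a : ℝ) (b : ℝ) (_ : a < b) (_ : b ≤ a + 2 * Real.pi),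
    ((∫⁻ x in Ioc a b, γ x) / ENNReal.ofReal (b - a)) *
      ((∫⁻ x in Ioc a b, γ x ^ (-1 / (p - 1))) / ENNReal.ofReal (b - a)) ^ (p - 1)

/-- The class `𝔖₁`: bounded means over intervals, and a positive lower bound a.e. -/
def SOne (γ : ℝ → ℝ≥0∞) : Prop :=
  sOneConst γ < ∞ ∧ ∃ c : ℝ≥0, 0 < c ∧ ∀ᵐ x, (c : ℝ≥0∞) ≤ γ x

/-- The class `A𝔖ₚ¹`: the Muckenhoupt class `Aₚ` for `1 < p < ∞`, the class `𝔖₁` for `p = 1`,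
and the trivial weight only for `p = ∞`. -/
structure ASClass (p : ℝ≥0∞) (γ : ℝ → ℝ≥0∞) : Prop where
  weight : IsWeight γ
  one : p = 1 → SOne γ
  muckenhoupt : 1 < p → p < ∞ → muckenhouptConst p.toReal γ < ∞
  top : p = ∞ → ∀ᵐ x, γ x = 1

/-- The constant `[γ]` attached to a weight of the class `A𝔖ₚ¹`
(there is nothing to measure when `p = ∞`, where `γ ≡ 1`). -/
def weightConst (p : ℝ≥0∞) (γ : ℝ → ℝ≥0∞) : ℝ≥0∞ :=
  if p = ∞ then 1 else if p = 1 then sOneConst γ else muckenhouptConst p.toReal γ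

/-- The measure `γ(x) dx` on one period. -/
def weightMeasure (γ : ℝ → ℝ≥0∞) : Measure ℝ :=
  (volume.restrict (Ioc (-Real.pi) Real.pi)).withDensity γ

/-- The weighted norm `‖f‖_{p,γ}`: `(∫ |f|^p γ)^(1/p)` for `p < ∞`, and the essential supremum
for `p = ∞` (as `γ > 0` a.e., the weight does not change the null sets). -/
def wNorm (p : ℝ≥0∞) (γ : ℝ → ℝ≥0∞) (f : ℝ → ℝ) : ℝ≥0∞ :=
  eLpNorm f p (weightMeasure γ)

/-- `f ∈ L_{p,γ}`, functions on the circle being `2π`-periodic functions on the line. -/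
structure MemWLp (p : ℝ≥0∞) (γ : ℝ → ℝ≥0∞) (f : ℝ → ℝ) : Prop where
  periodic : Function.Periodic f (2 * Real.pi)
  memLp : MemLp f p (weightMeasure γ)

/-- The one-sided Steklov mean `𝔗_v f (x) = (1/v) ∫_x^{x+v} f`, `v > 0`. -/
def steklov (v : ℝ) (f : ℝ → ℝ) : ℝ → ℝ :=
  fun x => (1 / v) * ∫ t in x..(x + v), f t

/-- The operator `I - 𝔗_v`. -/
def steklovDiff (v : ℝ) (f : ℝ → ℝ) : ℝ → ℝ :=
  fun x => f x - steklov v f x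

/-- The modulus of smoothness `Ω_r(f, v)_{p,γ} = ‖(I - 𝔗_v)^r f‖_{p,γ}`, `v > 0`. -/
def modulus (r : ℕ) (f : ℝ → ℝ) (v : ℝ) (p : ℝ≥0∞) (γ : ℝ → ℝ≥0∞) : ℝ≥0∞ :=
  wNorm p γ ((steklovDiff v)^[r] f)

/-- The class `Π_n` of real trigonometric polynomials of degree at most `n`. -/
def trigPoly (n : ℕ) : Set (ℝ → ℝ) :=
  {u | ∃ a b : ℕ → ℝ, ∀ x : ℝ,
    u x = a 0 + ∑ k ∈ Finset.Icc 1 n, (a k * Real.cos (k * x) + b k * Real.sin (k * x))}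

/-- The best approximation `E_n(f)_{p,γ}` by trigonometric polynomials of degree at most `n`. -/
def bestApprox (n : ℕ) (f : ℝ → ℝ) (p : ℝ≥0∞) (γ : ℝ → ℝ≥0∞) : ℝ≥0∞ :=
  ⨅ u ∈ trigPoly n, wNorm p γ (fun x => f x - u x)

end WeightedJackson

end

/-!
The proof rests on local averages and on an explicit Fourier multiplier; it uses neither the maximal
function nor a `K`-functional.

*Reduction.* Put `v = 1 / n`, `S = I - 𝔗_v` and `g = S^r f`. Then
`f = (I - S^r)² f + 2 g - S^r g`. The last two terms are controlled by `‖g‖`, because `𝔗_v` is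
bounded on the weighted space. The first one is smoother than `f`: its Fourier coefficients are
`(1 - (1 - m(k v))^r)²` times those of `f`, where `m(t) = (e^{it} - 1) / (it)` decays like `1 / t`.
Truncating its Fourier series smoothly with a cutoff `η(k / n)` leaves an error which is the image
of `g` under the multiplier `ψ(k / n)`, `ψ = (1 - η) (1 - (1 - m)^r)² / (1 - m)^r`
(`jacksonSymbol`, `exists_trigPoly_smooth_part`).

*The kernel.* The denominator does no harm, since `|1 - m|` is bounded below away from the origin,
where `1 - η` lives. So `ψ` and its first two derivatives are `O(1 / (1 + t²))`
(`bddTwo_jacksonSymbol`). Summing the coefficients, respectively their second differences, bounds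
the kernel `∑ ψ(k / n) e^{ikx}` by a multiple of `n / (1 + (n x)²)` (`exists_norm_symbolKernel_le`).

*Weighted estimates.* That model kernel is dominated by a sum of normalised indicators of dyadic
windows with geometrically decaying weights, so everything reduces to a bound, uniform in `h ≤ π`, for the local
averages over `(x - h, x + h]` (`exists_avgBounded`). For `1 < p < ∞`, with `J_x = (x - h, x + h]`,
Hölder's inequality and the Muckenhoupt condition on `J_x` itself give, for the average `Bf(x)`,
`(Bf(x))^p γ(x) ≤ 2^p [γ]_p (γ(x) / γ(J_x)) ∫_{J_x} |f|^p γ`. After Fubini it remains to see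
that `∫_{|x - y| < h} γ(x) / γ(J_x) dx ≤ 2`, which holds because each half of the window about `y`
is contained in `J_x` for every `x` in that half. For `p = 1` the weight is bounded above in mean
and below by a constant, and for `p = ∞` the bound is trivial.
-/

noncomputable section

namespace WeightedJackson

/-! ### Integrals of periodic functions over a period -/

lemma setLIntegral_Ioc_comp_add (F : ℝ → ℝ≥0∞) (x a b : ℝ) :
    ∫⁻ t in Ioc a b, F (x + t) = ∫⁻ y in Ioc (x + a) (x + b), F y := by
  have := (measurePreserving_add_left volume x).setLIntegral_comp_preimage_emb
    (measurableEmbedding_addLeft x) F (Ioc (x + a) (x + b))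
  simpa using this

lemma setLIntegral_Ioc_comp_sub (F : ℝ → ℝ≥0∞) (x a b : ℝ) :
    ∫⁻ t in Ioc a b, F (x - t) = ∫⁻ y in Ico (x - b) (x - a), F y := by
  have := (volume.measurePreserving_sub_left x).setLIntegral_comp_preimage_emb
    (MeasurableEquiv.subLeft x).measurableEmbedding F (Ico (x - b) (x - a))
  simpa using this

lemma setLIntegral_period_eq {F : ℝ → ℝ≥0∞} (hF : Function.Periodic F (2 * Real.pi)) (a b : ℝ) :
    ∫⁻ x in Ioc a (a + 2 * Real.pi), F x = ∫⁻ x in Ioc b (b + 2 * Real.pi), F x := by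
  have : VAddInvariantMeasure (AddSubgroup.zmultiples (2 * Real.pi)) ℝ volume :=
    ⟨fun c s _ => measure_preimage_add _ _ _⟩
  exact (isAddFundamentalDomain_Ioc Real.two_pi_pos a).setLIntegral_eq
    (isAddFundamentalDomain_Ioc Real.two_pi_pos b) F fun g x => hF.map_vadd_zmultiples g x

lemma Ioc_neg_pi_pi : Ioc (-Real.pi) Real.pi = Ioc (-Real.pi) (-Real.pi + 2 * Real.pi) := by
  congr 1; ring

lemma setLIntegral_period_comp_add {F : ℝ → ℝ≥0∞} (hF : Function.Periodic F (2 * Real.pi))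
    (t : ℝ) :
    ∫⁻ x in Ioc (-Real.pi) Real.pi, F (x + t) = ∫⁻ x in Ioc (-Real.pi) Real.pi, F x := by
  simp_rw [add_comm _ t]
  rw [setLIntegral_Ioc_comp_add, Ioc_neg_pi_pi, ← setLIntegral_period_eq hF (t + -Real.pi)]
  congr 3; ring

lemma ae_of_periodic {P : ℝ → Prop} (hP : ∀ x, P (x + 2 * Real.pi) ↔ P x)
    (h : ∀ᵐ x ∂(volume.restrict (Ioc (-Real.pi) Real.pi)), P x) : ∀ᵐ x, P x := by
  have : VAddInvariantMeasure (AddSubgroup.zmultiples (2 * Real.pi)) ℝ volume :=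
    ⟨fun c s _ => measure_preimage_add _ _ _⟩
  have hper : Function.Periodic P (2 * Real.pi) := fun x => propext (hP x)
  rw [ae_iff] at h ⊢
  rw [Ioc_neg_pi_pi, Measure.restrict_apply' measurableSet_Ioc] at h
  refine (isAddFundamentalDomain_Ioc Real.two_pi_pos (-Real.pi)).measure_zero_of_invariant _
    (fun g => ?_) h
  ext x
  rw [mem_vadd_set_iff_neg_vadd_mem, mem_ofPred_eq, mem_ofPred_eq, hper.map_vadd_zmultiples]

lemma aestronglyMeasurable_of_periodic {f : ℝ → ℝ} (hf : Function.Periodic f (2 * Real.pi))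
    (h : AEStronglyMeasurable f (volume.restrict (Ioc (-Real.pi) Real.pi))) :
    AEStronglyMeasurable f := by
  have : Fact (0 < 2 * Real.pi) := ⟨Real.two_pi_pos⟩
  have hm : Measurable (fun x : ℝ => toIocMod Real.two_pi_pos (-Real.pi) x) :=
    measurable_subtype_coe.comp
      ((AddCircle.measurableEquivIoc (2 * Real.pi) (-Real.pi)).measurable.comp
        AddCircle.measurable_mk')
  refine ⟨fun x => h.mk f (toIocMod Real.two_pi_pos (-Real.pi) x),
    h.stronglyMeasurable_mk.comp_measurable hm, ae_of_periodic (fun x => ?_) ?_⟩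
  · simp only [hf x, toIocMod_add_right]
  · filter_upwards [h.ae_eq_mk, ae_restrict_mem measurableSet_Ioc] with x hx hxm
    rw [(toIocMod_eq_self Real.two_pi_pos).2 (by rwa [← Ioc_neg_pi_pi]), hx]

/-- Fubini's theorem for a correlation over the circle: shifting the argument of one factor
is the same as shifting the argument of the other factor backwards. -/
lemma lintegral_correlation {w H : ℝ → ℝ≥0∞} (hw : AEMeasurable w) (hH : AEMeasurable H)
    (hwp : Function.Periodic w (2 * Real.pi)) (hHp : Function.Periodic H (2 * Real.pi)) (h : ℝ) :
    ∫⁻ x in Ioc (-Real.pi) Real.pi, w x * ∫⁻ t in Ioc (-h) h, H (x + t) =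
      ∫⁻ y in Ioc (-Real.pi) Real.pi, H y * ∫⁻ t in Ioc (-h) h, w (y - t) := by
  set μ := (volume : Measure ℝ).restrict (Ioc (-Real.pi) Real.pi)
  set ν := (volume : Measure ℝ).restrict (Ioc (-h) h)
  have hac : μ.prod ν ≪ (volume : Measure ℝ).prod volume :=
    Measure.AbsolutelyContinuous.prod Measure.restrict_le_self.absolutelyContinuous
      Measure.restrict_le_self.absolutelyContinuous
  have hadd : Measure.QuasiMeasurePreserving (fun z : ℝ × ℝ => z.1 + z.2)
      ((volume : Measure ℝ).prod volume) volume :=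
    Measure.quasiMeasurePreserving_snd.comp
      (measurePreserving_prod_add (volume : Measure ℝ) volume).quasiMeasurePreserving
  have hsub : Measure.QuasiMeasurePreserving (fun z : ℝ × ℝ => z.1 - z.2)
      ((volume : Measure ℝ).prod volume) volume := quasiMeasurePreserving_sub _ _
  have m1 : AEMeasurable (fun z : ℝ × ℝ => w z.1 * H (z.1 + z.2)) (μ.prod ν) :=
    ((hw.comp_quasiMeasurePreserving Measure.quasiMeasurePreserving_fst).mul
      (hH.comp_quasiMeasurePreserving hadd)).mono_ac hac
  have m2 : AEMeasurable (fun z : ℝ × ℝ => H z.1 * w (z.1 - z.2)) (μ.prod ν) :=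
    ((hH.comp_quasiMeasurePreserving Measure.quasiMeasurePreserving_fst).mul
      (hw.comp_quasiMeasurePreserving hsub)).mono_ac hac
  have e1 : ∀ x, w x * ∫⁻ t, H (x + t) ∂ν = ∫⁻ t, w x * H (x + t) ∂ν := fun x =>
    (lintegral_const_mul'' _ ((hH.comp_quasiMeasurePreserving
      (measurePreserving_add_left volume x).quasiMeasurePreserving).restrict)).symm
  have e2 : ∀ x, H x * ∫⁻ t, w (x - t) ∂ν = ∫⁻ t, H x * w (x - t) ∂ν := fun x =>
    (lintegral_const_mul'' _ ((hw.comp_quasiMeasurePreserving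
      (volume.measurePreserving_sub_left x).quasiMeasurePreserving).restrict)).symm
  simp_rw [e1, e2]
  rw [lintegral_lintegral_swap (f := fun x t => w x * H (x + t)) m1,
    lintegral_lintegral_swap (f := fun y t => H y * w (y - t)) m2]
  refine lintegral_congr fun t => ?_
  have hp : Function.Periodic (fun y => H y * w (y - t)) (2 * Real.pi) := fun y => by
    simp only [hHp y, add_sub_right_comm, hwp (y - t)]
  rw [← setLIntegral_period_comp_add hp t]
  exact lintegral_congr fun x => by simp [mul_comm]

/-! ### Local averages in weighted spaces -/

/-- The two-sided local average `h⁻¹ ∫_{-h}^{h} F(x + t) dt` of a nonnegative function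
(normalised by `h` rather than by the length `2h`). -/
def locAvg (h : ℝ) (F : ℝ → ℝ≥0∞) (x : ℝ) : ℝ≥0∞ :=
  (∫⁻ t in Ioc (-h) h, F (x + t)) / ENNReal.ofReal h

/-- `C` bounds the local averages at all scales `h ≤ π` on the weighted space. -/
def AvgBounded (p : ℝ≥0∞) (γ : ℝ → ℝ≥0∞) (C : ℝ≥0∞) : Prop :=
  ∀ F : ℝ → ℝ≥0∞, AEMeasurable F → Function.Periodic F (2 * Real.pi) →
    ∀ h : ℝ, 0 < h → h ≤ Real.pi →
      eLpNorm (locAvg h F) p (weightMeasure γ) ≤ C * eLpNorm F p (weightMeasure γ)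

lemma setLIntegral_window_eq (F : ℝ → ℝ≥0∞) (x h : ℝ) :
    ∫⁻ t in Ioc (-h) h, F (x + t) = ∫⁻ y in Ioc (x - h) (x + h), F y := by
  rw [setLIntegral_Ioc_comp_add, sub_eq_add_neg]

lemma locAvg_eq (h : ℝ) (F : ℝ → ℝ≥0∞) (x : ℝ) :
    locAvg h F x = (∫⁻ y in Ioc (x - h) (x + h), F y) / ENNReal.ofReal h := by
  rw [locAvg, setLIntegral_window_eq]

lemma measurable_setLIntegral_comp_add {F : ℝ → ℝ≥0∞} (hF : AEMeasurable F) (a b : ℝ) :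
    Measurable (fun x => ∫⁻ t in Ioc a b, F (x + t)) := by
  have h : ∀ x, ∫⁻ t in Ioc a b, F (x + t) = ∫⁻ t in Ioc a b, hF.mk F (x + t) := fun x =>
    lintegral_congr_ae (ae_restrict_of_ae
      ((measurePreserving_add_left volume x).quasiMeasurePreserving.ae_eq_comp hF.ae_eq_mk))
  simp_rw [h]
  exact (hF.measurable_mk.comp measurable_add).lintegral_prod_right'

lemma measurable_locAvg {F : ℝ → ℝ≥0∞} (hF : AEMeasurable F) (h : ℝ) :
    Measurable (locAvg h F) :=
  (measurable_setLIntegral_comp_add hF _ _).div_const _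

lemma lintegral_weightMeasure {γ : ℝ → ℝ≥0∞} (hγ : Measurable γ) {F : ℝ → ℝ≥0∞}
    (hF : AEMeasurable F) :
    ∫⁻ x, F x ∂(weightMeasure γ) = ∫⁻ x in Ioc (-Real.pi) Real.pi, γ x * F x := by
  rw [weightMeasure, lintegral_withDensity_eq_lintegral_mul₀ hγ.aemeasurable hF.restrict]
  rfl

namespace IsWeight

lemma ae_lt_top {γ : ℝ → ℝ≥0∞} (hγ : IsWeight γ) : ∀ᵐ x, γ x < ∞ :=
  ae_of_periodic (fun x => by rw [hγ.periodic x])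
    (MeasureTheory.ae_lt_top hγ.measurable hγ.integrable.ne)

lemma setLIntegral_lt_top {γ : ℝ → ℝ≥0∞} (hγ : IsWeight γ) {a b : ℝ} (hab : b ≤ a + 2 * Real.pi) :
    ∫⁻ x in Ioc a b, γ x < ∞ := by
  refine lt_of_le_of_lt (lintegral_mono_set (Ioc_subset_Ioc_right hab)) ?_
  rw [setLIntegral_period_eq hγ.periodic a (-Real.pi), ← Ioc_neg_pi_pi]
  exact hγ.integrable

lemma setLIntegral_pos {γ : ℝ → ℝ≥0∞} (hγ : IsWeight γ) {a b : ℝ} (hab : a < b) :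
    0 < ∫⁻ x in Ioc a b, γ x := by
  rw [lintegral_pos_iff_support hγ.measurable]
  have : (Function.support γ) =ᵐ[volume.restrict (Ioc a b)] (univ : Set ℝ) := by
    filter_upwards [ae_restrict_of_ae hγ.pos] with x hx
    exact propext ⟨fun _ => trivial, fun _ => hx.ne'⟩
  rw [measure_congr this]
  simp [hab]

lemma restrict_absolutelyContinuous {γ : ℝ → ℝ≥0∞} (hγ : IsWeight γ) :
    volume.restrict (Ioc (-Real.pi) Real.pi) ≪ weightMeasure γ :=
  withDensity_absolutelyContinuous' hγ.measurable.aemeasurable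
    (ae_restrict_of_ae (hγ.pos.mono fun _ h => h.ne'))

lemma ae_of_ae_weightMeasure {γ : ℝ → ℝ≥0∞} (hγ : IsWeight γ)
    {P : ℝ → Prop} (hP : ∀ x, P (x + 2 * Real.pi) ↔ P x)
    (h : ∀ᵐ x ∂(weightMeasure γ), P x) : ∀ᵐ x, P x :=
  ae_of_periodic hP (hγ.restrict_absolutelyContinuous.ae_le h)

/-- Half of a window of radius `h` is contained in the window of radius `h` about each of its
points, so that the mass it carries relative to those windows is at most one. -/
lemma setLIntegral_div_le_one {γ : ℝ → ℝ≥0∞} (hγ : IsWeight γ)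
    {A : Set ℝ} (hA : MeasurableSet A) {h : ℝ}
    (hAh : ∀ x ∈ A, A ⊆ Ioc (x - h) (x + h)) :
    ∫⁻ x in A, γ x / ∫⁻ y in Ioc (x - h) (x + h), γ y ≤ 1 := by
  calc ∫⁻ x in A, γ x / ∫⁻ y in Ioc (x - h) (x + h), γ y
      ≤ ∫⁻ x in A, γ x / ∫⁻ y in A, γ y := by
        refine setLIntegral_mono' hA fun x hx => ?_
        exact ENNReal.div_le_div_left (lintegral_mono_set (hAh x hx)) _
    _ = (∫⁻ x in A, γ x) / ∫⁻ y in A, γ y := by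
        simp_rw [div_eq_mul_inv]
        rw [lintegral_mul_const _ hγ.measurable]
    _ ≤ 1 := ENNReal.div_self_le_one

lemma setLIntegral_comp_sub_div_le_two {γ : ℝ → ℝ≥0∞} (hγ : IsWeight γ)
    {h : ℝ} (hh : 0 < h) (y : ℝ) :
    ∫⁻ t in Ioc (-h) h, (fun x => γ x / ∫⁻ z in Ioc (x - h) (x + h), γ z) (y - t) ≤ 2 := by
  rw [setLIntegral_Ioc_comp_sub (fun x => γ x / ∫⁻ z in Ioc (x - h) (x + h), γ z), sub_neg_eq_add,
    ← Ico_union_Ico_eq_Ico (show y - h ≤ y by linarith) (show y ≤ y + h by linarith)]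
  refine (lintegral_union_le _ _ _).trans ?_
  rw [← one_add_one_eq_two]
  gcongr
  · refine hγ.setLIntegral_div_le_one measurableSet_Ico fun x hx z hz => ?_
    exact ⟨by linarith [hx.2, hz.1], by linarith [hx.1, hz.2]⟩
  · refine hγ.setLIntegral_div_le_one measurableSet_Ico fun x hx z hz => ?_
    exact ⟨by linarith [hx.2, hz.1], by linarith [hx.1, hz.2]⟩

end IsWeight

/-- Hölder's inequality against the dual weight `γ ^ (-1 / (P - 1))`. -/
lemma rpow_setLIntegral_le {γ : ℝ → ℝ≥0∞} (hγ : IsWeight γ) {P : ℝ} (hP : 1 < P)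
    {F : ℝ → ℝ≥0∞} (hF : AEMeasurable F) (s : Set ℝ) :
    (∫⁻ x in s, F x) ^ P ≤
      (∫⁻ x in s, F x ^ P * γ x) * (∫⁻ x in s, γ x ^ (-1 / (P - 1))) ^ (P - 1) := by
  have hP0 : 0 < P := by linarith
  have hP1 : 0 < P - 1 := by linarith
  have hpq := Real.HolderConjugate.conjExponent hP
  set q := P.conjExponent
  have hq : q = P / (P - 1) := rfl
  have hq0 : 0 < q := hpq.symm.pos
  have key : ∫⁻ x in s, F x ≤ (∫⁻ x in s, F x ^ P * γ x) ^ (1 / P) *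
      (∫⁻ x in s, γ x ^ (-1 / (P - 1))) ^ (1 / q) := by
    have h := ENNReal.lintegral_mul_le_Lp_mul_Lq (volume.restrict s) hpq
      (f := fun x => F x * γ x ^ (1 / P)) (g := fun x => γ x ^ (-1 / P))
      (hF.restrict.mul (hγ.measurable.pow_const _).aemeasurable)
      (hγ.measurable.pow_const _).aemeasurable
    refine (le_of_eq ?_).trans (h.trans (le_of_eq ?_))
    · refine lintegral_congr_ae (ae_restrict_of_ae ?_)
      filter_upwards [hγ.pos, hγ.ae_lt_top] with x h0 h1
      simp only [Pi.mul_apply]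
      rw [mul_assoc, ← ENNReal.rpow_add _ _ h0.ne' h1.ne]
      simp [neg_div]
    · congr 2
      · congr 1
        funext x
        rw [ENNReal.mul_rpow_of_nonneg _ _ hP0.le, ← ENNReal.rpow_mul, one_div_mul_cancel hP0.ne',
          ENNReal.rpow_one]
      · congr 1
        funext x
        rw [← ENNReal.rpow_mul, hq]
        congr 1
        field_simp
  calc (∫⁻ x in s, F x) ^ P ≤ _ := ENNReal.rpow_le_rpow key hP0.le
    _ = _ := by
      rw [ENNReal.mul_rpow_of_nonneg _ _ hP0.le, ← ENNReal.rpow_mul, ← ENNReal.rpow_mul,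
        one_div_mul_cancel hP0.ne', ENNReal.rpow_one]
      congr 2
      rw [hq]; field_simp

/-- The pointwise form of the Muckenhoupt condition: the `P`-th power of an average of `F`,
times the mass of the window, is controlled by the weighted `P`-th moment of `F`. -/
lemma rpow_locAvg_mul_le {γ : ℝ → ℝ≥0∞} (hγ : IsWeight γ) {P : ℝ} (hP : 1 < P)
    {F : ℝ → ℝ≥0∞} (hF : AEMeasurable F) {h : ℝ} (hh : 0 < h) (hπ : h ≤ Real.pi) (x : ℝ) :
    locAvg h F x ^ P * (∫⁻ y in Ioc (x - h) (x + h), γ y) ≤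
      2 ^ P * muckenhouptConst P γ * ∫⁻ y in Ioc (x - h) (x + h), F y ^ P * γ y := by
  have hP0 : 0 < P := by linarith
  have hP1 : 0 < P - 1 := by linarith
  rw [locAvg_eq]
  set J := Ioc (x - h) (x + h)
  set G := ∫⁻ y in J, γ y
  set σ := ∫⁻ y in J, γ y ^ (-1 / (P - 1))
  set I := ∫⁻ y in J, F y ^ P * γ y
  set L := ENNReal.ofReal ((x + h) - (x - h)) with hL
  have hL2 : L = 2 * ENNReal.ofReal h := by
    rw [hL, show (x + h) - (x - h) = 2 * h by ring, ENNReal.ofReal_mul (by norm_num)]; simp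
  have hh0 : ENNReal.ofReal h ≠ 0 := by simpa using hh
  have hL0 : L ≠ 0 := by rw [hL2]; exact mul_ne_zero (by norm_num) hh0
  have hLt : L ≠ ∞ := ENNReal.ofReal_ne_top
  have hA : G / L * (σ / L) ^ (P - 1) ≤ muckenhouptConst P γ := by
    unfold muckenhouptConst
    exact le_iSup₂_of_le (x - h) (x + h) (le_iSup₂_of_le (by linarith) (by linarith) le_rfl)
  have e1 : (∫⁻ y in J, F y) / ENNReal.ofReal h = 2 * ((∫⁻ y in J, F y) / L) := by
    rw [hL2, div_eq_mul_inv, div_eq_mul_inv,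
      ENNReal.mul_inv (Or.inl (by norm_num)) (Or.inl (by norm_num)), mul_left_comm, ← mul_assoc 2,
      ENNReal.mul_inv_cancel (by norm_num) (by norm_num), one_mul]
  have e2 : L ^ P = L * L ^ (P - 1) := by
    conv_rhs => rw [← ENNReal.rpow_one L, ← ENNReal.rpow_mul, ← ENNReal.rpow_add _ _ hL0 hLt]
    congr 1; ring
  calc ((∫⁻ y in J, F y) / ENNReal.ofReal h) ^ P * G
      = 2 ^ P * ((∫⁻ y in J, F y) ^ P / L ^ P * G) := by
        rw [e1, ENNReal.mul_rpow_of_nonneg _ _ hP0.le, ENNReal.div_rpow_of_nonneg _ _ hP0.le,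
          mul_assoc]
    _ ≤ 2 ^ P * ((I * σ ^ (P - 1)) / L ^ P * G) := by
        gcongr
        exact rpow_setLIntegral_le hγ hP hF J
    _ = 2 ^ P * (I * (G / L * (σ / L) ^ (P - 1))) := by
        rw [ENNReal.div_rpow_of_nonneg _ _ hP1.le, e2]
        simp only [div_eq_mul_inv]
        rw [ENNReal.mul_inv (Or.inl hL0) (Or.inl hLt)]
        ring
    _ ≤ 2 ^ P * (I * muckenhouptConst P γ) := by gcongr
    _ = _ := by ring

lemma lintegral_rpow_locAvg_le {γ : ℝ → ℝ≥0∞} (hγ : IsWeight γ) {P : ℝ} (hP : 1 < P)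
    {F : ℝ → ℝ≥0∞} (hF : AEMeasurable F) (hFp : Function.Periodic F (2 * Real.pi))
    {h : ℝ} (hh : 0 < h) (hπ : h ≤ Real.pi) :
    ∫⁻ x, locAvg h F x ^ P ∂(weightMeasure γ) ≤
      2 ^ P * muckenhouptConst P γ * 2 * ∫⁻ x, F x ^ P ∂(weightMeasure γ) := by
  have hP0 : 0 < P := by linarith
  set G : ℝ → ℝ≥0∞ := fun x => ∫⁻ y in Ioc (x - h) (x + h), γ y with hG
  have hGm : Measurable G := by
    have := measurable_setLIntegral_comp_add hγ.measurable.aemeasurable (-h) h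
    simpa only [setLIntegral_window_eq] using this
  have hGp : Function.Periodic G (2 * Real.pi) := fun x => by
    simp only [hG, ← setLIntegral_window_eq, add_right_comm x, hγ.periodic _]
  set H : ℝ → ℝ≥0∞ := fun y => F y ^ P * γ y with hH
  have hHm : AEMeasurable H := (hF.pow_const _).mul hγ.measurable.aemeasurable
  rw [lintegral_weightMeasure hγ.measurable ((measurable_locAvg hF h).pow_const P).aemeasurable,
    lintegral_weightMeasure hγ.measurable (hF.pow_const P)]
  calc ∫⁻ x in Ioc (-Real.pi) Real.pi, γ x * locAvg h F x ^ P
      ≤ ∫⁻ x in Ioc (-Real.pi) Real.pi, 2 ^ P * muckenhouptConst P γ *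
          ((fun x => γ x / G x) x * ∫⁻ t in Ioc (-h) h, H (x + t)) := by
        refine lintegral_mono fun x => ?_
        have h0 : G x ≠ 0 := (hγ.setLIntegral_pos (by linarith)).ne'
        have h1 : G x ≠ ∞ := (hγ.setLIntegral_lt_top (by linarith)).ne
        have hx := rpow_locAvg_mul_le hγ hP hF hh hπ x
        rw [← ENNReal.le_div_iff_mul_le (Or.inl h0) (Or.inl h1)] at hx
        refine (mul_le_mul_right hx (γ x)).trans (le_of_eq ?_)
        rw [setLIntegral_window_eq]
        simp only [div_eq_mul_inv, hH]
        ring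
    _ = 2 ^ P * muckenhouptConst P γ * ∫⁻ x in Ioc (-Real.pi) Real.pi,
          ((fun x => γ x / G x) x * ∫⁻ t in Ioc (-h) h, H (x + t)) :=
        lintegral_const_mul _ ((hγ.measurable.div hGm).mul
          (measurable_setLIntegral_comp_add hHm _ _))
    _ = 2 ^ P * muckenhouptConst P γ * ∫⁻ y in Ioc (-Real.pi) Real.pi,
          (H y * ∫⁻ t in Ioc (-h) h, (fun x => γ x / G x) (y - t)) := by
        rw [← lintegral_correlation (w := fun x => γ x / G x)
          (hγ.measurable.div hGm).aemeasurable hHm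
          (fun x => by simp only [hγ.periodic x, hGp x])
          (fun x => by simp only [hH, hγ.periodic x, hFp x])]
    _ ≤ 2 ^ P * muckenhouptConst P γ * ∫⁻ y in Ioc (-Real.pi) Real.pi, (H y * 2) := by
        gcongr with y
        exact hγ.setLIntegral_comp_sub_div_le_two hh y
    _ = _ := by
        rw [lintegral_mul_const'' _ hHm.restrict, mul_comm (lintegral _ _) 2, ← mul_assoc]
        simp only [hH, mul_comm (γ _)]

lemma avgBounded_of_muckenhoupt {p : ℝ≥0∞} {γ : ℝ → ℝ≥0∞} (hγ : IsWeight γ) (h1 : 1 < p)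
    (hp : p < ∞) :
    AvgBounded p γ ((2 ^ p.toReal * muckenhouptConst p.toReal γ * 2) ^ (1 / p.toReal)) := by
  intro F hF hFp h hh hπ
  have hP : 1 < p.toReal := by
    rw [← ENNReal.toReal_one]; exact (ENNReal.toReal_lt_toReal (by simp) hp.ne).2 h1
  have h0 : 0 ≤ 1 / p.toReal := by positivity
  rw [eLpNorm_eq_lintegral_rpow_enorm_toReal (by positivity) hp.ne,
    eLpNorm_eq_lintegral_rpow_enorm_toReal (by positivity) hp.ne,
    ← ENNReal.mul_rpow_of_nonneg _ _ h0]
  exact ENNReal.rpow_le_rpow (lintegral_rpow_locAvg_le hγ hP hF hFp hh hπ) h0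

lemma avgBounded_one {γ : ℝ → ℝ≥0∞} (hγ : IsWeight γ) {c : ℝ≥0} (hc : 0 < c)
    (hcγ : ∀ᵐ x, (c : ℝ≥0∞) ≤ γ x) : AvgBounded 1 γ (2 * sOneConst γ / c) := by
  intro F hF hFp h hh hπ
  rw [eLpNorm_one_eq_lintegral_enorm, eLpNorm_one_eq_lintegral_enorm]
  simp only [enorm_eq_self]
  rw [lintegral_weightMeasure hγ.measurable (measurable_locAvg hF h).aemeasurable,
    lintegral_weightMeasure hγ.measurable hF]
  have hh0 : ENNReal.ofReal h ≠ 0 := by simpa using hh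
  have hwin : ∀ y, ∫⁻ t in Ioc (-h) h, γ (y - t) ≤ sOneConst γ * (2 * ENNReal.ofReal h) := by
    intro y
    have hs : (∫⁻ x in Ioc (y - h) (y + h), γ x) / ENNReal.ofReal ((y + h) - (y - h)) ≤
        sOneConst γ := by
      unfold sOneConst
      exact le_iSup₂_of_le (y - h) (y + h) (le_iSup₂_of_le (by linarith) (by linarith) le_rfl)
    rw [show (y + h) - (y - h) = 2 * h by ring, ENNReal.ofReal_mul (by norm_num),
      ENNReal.ofReal_ofNat, ENNReal.div_le_iff (mul_ne_zero (by norm_num) hh0)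
      (ENNReal.mul_ne_top (by norm_num) ENNReal.ofReal_ne_top)] at hs
    rwa [setLIntegral_Ioc_comp_sub, sub_neg_eq_add, setLIntegral_congr Ico_ae_eq_Ioc]
  calc ∫⁻ x in Ioc (-Real.pi) Real.pi, γ x * locAvg h F x
      = ∫⁻ x in Ioc (-Real.pi) Real.pi, (ENNReal.ofReal h)⁻¹ *
          (γ x * ∫⁻ t in Ioc (-h) h, F (x + t)) := by
        refine lintegral_congr fun x => ?_
        rw [locAvg, div_eq_mul_inv]; ring
    _ = (ENNReal.ofReal h)⁻¹ * ∫⁻ y in Ioc (-Real.pi) Real.pi,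
          F y * ∫⁻ t in Ioc (-h) h, γ (y - t) := by
        rw [lintegral_const_mul' _ _ (ENNReal.inv_ne_top.2 hh0),
          lintegral_correlation hγ.measurable.aemeasurable hF hγ.periodic hFp]
    _ ≤ (ENNReal.ofReal h)⁻¹ * ∫⁻ y in Ioc (-Real.pi) Real.pi,
          (γ y * F y) * ((c : ℝ≥0∞)⁻¹ * (sOneConst γ * (2 * ENNReal.ofReal h))) := by
        refine mul_le_mul_right ?_ _
        refine lintegral_mono_ae (ae_restrict_of_ae ?_)
        filter_upwards [hcγ] with y hy
        have hc1 : 1 ≤ γ y * (c : ℝ≥0∞)⁻¹ := by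
          rw [← ENNReal.mul_inv_cancel (a := (c : ℝ≥0∞)) (by simpa using hc.ne') (by simp)]
          gcongr
        calc F y * _ ≤ F y * (sOneConst γ * (2 * ENNReal.ofReal h)) := by gcongr; exact hwin y
          _ = 1 * (F y * (sOneConst γ * (2 * ENNReal.ofReal h))) := (one_mul _).symm
          _ ≤ (γ y * (c : ℝ≥0∞)⁻¹) * (F y * (sOneConst γ * (2 * ENNReal.ofReal h))) := by gcongr
          _ = _ := by ring
    _ = _ := by
        have hm : AEMeasurable (fun y => γ y * F y) := hγ.measurable.aemeasurable.mul hF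
        rw [lintegral_mul_const'' _ hm.restrict, div_eq_mul_inv]
        calc _ = ((ENNReal.ofReal h)⁻¹ * ENNReal.ofReal h) * (2 * sOneConst γ * (c : ℝ≥0∞)⁻¹ *
              ∫⁻ x in Ioc (-Real.pi) Real.pi, γ x * F x) := by
              ring
          _ = _ := by rw [ENNReal.inv_mul_cancel hh0 ENNReal.ofReal_ne_top, one_mul]

lemma avgBounded_top {γ : ℝ → ℝ≥0∞} (hγ : IsWeight γ) : AvgBounded ∞ γ 2 := by
  intro F hF hFp h hh _
  have hh0 : ENNReal.ofReal h ≠ 0 := by simpa using hh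
  rw [eLpNorm_exponent_top, eLpNorm_exponent_top]
  set M := eLpNormEssSup F (weightMeasure γ) with hM
  have hFM : ∀ᵐ y, F y ≤ M :=
    hγ.ae_of_ae_weightMeasure (fun x => by rw [hFp x]) (enorm_ae_le_eLpNormEssSup F _)
  refine eLpNormEssSup_le_of_ae_enorm_bound (Filter.Eventually.of_forall fun x => ?_)
  rw [enorm_eq_self, locAvg_eq, ENNReal.div_le_iff hh0 ENNReal.ofReal_ne_top]
  calc ∫⁻ y in Ioc (x - h) (x + h), F y ≤ ∫⁻ y in Ioc (x - h) (x + h), M :=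
        lintegral_mono_ae (ae_restrict_of_ae hFM)
    _ = 2 * M * ENNReal.ofReal h := by
        rw [setLIntegral_const, Real.volume_Ioc, show (x + h) - (x - h) = 2 * h by ring,
          ENNReal.ofReal_mul (by norm_num), ENNReal.ofReal_ofNat]
        ring

/-- Local averages are bounded on the weighted spaces, at every scale and with a constant that
depends on the weight only through its class constant. -/
lemma exists_avgBounded {p : ℝ≥0∞} (hp : 1 ≤ p) (K c : ℝ≥0) (hc : 0 < c) :
    ∃ C : ℝ≥0, ∀ γ : ℝ → ℝ≥0∞, ASClass p γ → weightConst p γ ≤ K →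
      (p = 1 → ∀ᵐ x : ℝ, (c : ℝ≥0∞) ≤ γ x) → AvgBounded p γ C := by
  have mono : ∀ {γ : ℝ → ℝ≥0∞} {C D : ℝ≥0∞}, AvgBounded p γ C → C ≤ D → AvgBounded p γ D :=
    fun hC hCD F hF hFp h hh hπ => (hC F hF hFp h hh hπ).trans (by gcongr)
  suffices H : ∃ C : ℝ≥0∞, C ≠ ∞ ∧ ∀ γ : ℝ → ℝ≥0∞, ASClass p γ → weightConst p γ ≤ K →
      (p = 1 → ∀ᵐ x : ℝ, (c : ℝ≥0∞) ≤ γ x) → AvgBounded p γ C by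
    obtain ⟨C, hC, H⟩ := H
    exact ⟨C.toNNReal, by rwa [ENNReal.coe_toNNReal hC]⟩
  rcases eq_or_ne p ∞ with rfl | hpt
  · exact ⟨2, by norm_num, fun γ hγ _ _ => avgBounded_top hγ.weight⟩
  rcases eq_or_ne p 1 with rfl | hp1
  · refine ⟨2 * K / c, (ENNReal.div_lt_top (by finiteness) (by simpa using hc.ne')).ne,
      fun γ hγ hK hcγ => mono (avgBounded_one hγ.weight hc (hcγ rfl)) ?_⟩
    rw [weightConst, if_neg hpt, if_pos rfl] at hK
    gcongr
  · refine ⟨(2 ^ p.toReal * K * 2) ^ (1 / p.toReal), ?_,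
      fun γ hγ hK _ => mono (avgBounded_of_muckenhoupt hγ.weight (lt_of_le_of_ne hp hp1.symm)
        hpt.lt_top) ?_⟩
    · refine ENNReal.rpow_ne_top_of_nonneg (by positivity) ?_
      exact ENNReal.mul_ne_top (ENNReal.mul_ne_top (ENNReal.rpow_ne_top_of_nonneg (by positivity)
        (by norm_num)) ENNReal.coe_ne_top) (by norm_num)
    · rw [weightConst, if_neg hpt, if_neg hp1] at hK
      gcongr

/-! ### Convolution with a kernel decaying quadratically at scale `1 / n` -/

/-- The model kernel `n / (1 + (n t)²)`. -/
def kerMajorant (n : ℕ) (t : ℝ) : ℝ := n / (1 + (n * t) ^ 2)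

/-- The correlation of `F` with the model kernel over a period. -/
def kerAvg (n : ℕ) (F : ℝ → ℝ≥0∞) (x : ℝ) : ℝ≥0∞ :=
  ∫⁻ t in Ioc (-Real.pi) Real.pi, ENNReal.ofReal (kerMajorant n t) * F (x + t)

/-- The dyadic scales `2 ^ j / n`, truncated at half a period. -/
def dyadicScale (n j : ℕ) : ℝ := min (2 ^ j / n) Real.pi

lemma dyadicScale_pos {n : ℕ} (hn : 1 ≤ n) (j : ℕ) : 0 < dyadicScale n j := by
  have : (0 : ℝ) < n := by exact_mod_cast hn
  exact lt_min (by positivity) Real.pi_pos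

/-- Each point of a period lies in a dyadic window on which the model kernel is dominated by the
normalised indicator, with geometrically decaying weights. -/
lemma exists_kerMajorant_le {n : ℕ} (hn : 1 ≤ n) {t : ℝ} (ht : t ∈ Ioc (-Real.pi) Real.pi) :
    ∃ j ∈ Finset.range (n + 3), t ∈ Ioc (-dyadicScale n j) (dyadicScale n j) ∧
      kerMajorant n t ≤ 4 / 2 ^ j / dyadicScale n j := by
  have hn0 : (0 : ℝ) < n := by exact_mod_cast hn
  have htop : n * |t| < 2 ^ (n + 2) := by
    have h1 : |t| < 4 := (abs_le.2 ⟨ht.1.le, ht.2⟩).trans_lt Real.pi_lt_four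
    have h2 : (n : ℝ) < 2 ^ n := by exact_mod_cast Nat.lt_two_pow_self
    calc n * |t| < n * 4 := by gcongr
      _ ≤ 2 ^ n * 4 := by gcongr
      _ = 2 ^ (n + 2) := by rw [pow_add]; norm_num
  have hex : ∃ j : ℕ, n * |t| < 2 ^ j := ⟨n + 2, htop⟩
  classical
  have hle : Nat.find hex ≤ n + 2 := Nat.find_min' hex htop
  -- The smallest window containing `t`: minimality bounds `n |t|` below, hence the kernel above.
  have hspec := Nat.find_spec hex
  have hmin : ∀ i, Nat.find hex = i + 1 → (2 : ℝ) ^ i ≤ n * |t| := fun i hi =>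
    not_lt.1 (Nat.find_min hex (by omega))
  set j := Nat.find hex
  have hd := dyadicScale_pos hn j
  have hd1 : dyadicScale n j ≤ 2 ^ j / n := min_le_left _ _
  have hlt : |t| < 2 ^ j / n := by rw [lt_div_iff₀ hn0, mul_comm]; exact hspec
  refine ⟨j, Finset.mem_range.2 (by omega), ⟨?_, ?_⟩, ?_⟩
  · rcases min_choice ((2 : ℝ) ^ j / n) Real.pi with h | h
    · rw [dyadicScale, h]; exact (abs_lt.1 hlt).1
    · rw [dyadicScale, h]; exact ht.1
  · exact le_min (abs_lt.1 hlt).2.le ht.2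
  · calc kerMajorant n t ≤ 4 / 2 ^ j / (2 ^ j / n) := by
          rw [kerMajorant, div_div, div_le_div_iff₀ (by positivity) (by positivity)]
          have hj : ((2 : ℝ) ^ j) ^ 2 ≤ 4 * (1 + (n * t) ^ 2) := by
            rcases hjj : j with _ | i
            · nlinarith [sq_nonneg (n * t)]
            · have h := hmin i hjj
              have h2 : ((2 : ℝ) ^ i) ^ 2 ≤ (n * |t|) ^ 2 := by gcongr
              rw [mul_pow, sq_abs] at h2
              rw [pow_succ (2 : ℝ) i]
              nlinarith
          calc (n : ℝ) * (2 ^ j * (2 ^ j / n)) = (2 ^ j) ^ 2 := by field_simp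
            _ ≤ _ := hj
      _ ≤ 4 / 2 ^ j / dyadicScale n j := by gcongr

lemma kerAvg_le_sum {n : ℕ} (hn : 1 ≤ n) {F : ℝ → ℝ≥0∞} (hF : AEMeasurable F) (x : ℝ) :
    kerAvg n F x ≤ ∑ j ∈ Finset.range (n + 3),
      ENNReal.ofReal (4 / 2 ^ j) * locAvg (dyadicScale n j) F x := by
  have hFx : AEMeasurable (fun t => F (x + t)) := hF.comp_quasiMeasurePreserving
    (measurePreserving_add_left volume x).quasiMeasurePreserving
  set c : ℕ → ℝ≥0∞ := fun j => ENNReal.ofReal (4 / 2 ^ j) / ENNReal.ofReal (dyadicScale n j)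
  set W : ℕ → Set ℝ := fun j => Ioc (-dyadicScale n j) (dyadicScale n j)
  calc kerAvg n F x
      ≤ ∫⁻ t in Ioc (-Real.pi) Real.pi, ∑ j ∈ Finset.range (n + 3),
          c j * (W j).indicator (fun t => F (x + t)) t := by
        refine setLIntegral_mono' measurableSet_Ioc fun t ht => ?_
        obtain ⟨j, hj, htj, hle⟩ := exists_kerMajorant_le hn ht
        refine le_trans ?_ (Finset.single_le_sum (f := fun j =>
          c j * (W j).indicator (fun t => F (x + t)) t) (fun _ _ => zero_le) hj)
        rw [indicator_of_mem htj]
        gcongr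
        simp only [c]
        rw [← ENNReal.ofReal_div_of_pos (dyadicScale_pos hn j)]
        exact ENNReal.ofReal_le_ofReal hle
    _ = ∑ j ∈ Finset.range (n + 3), ∫⁻ t in Ioc (-Real.pi) Real.pi,
          c j * (W j).indicator (fun t => F (x + t)) t :=
        lintegral_finsetSum' _ fun j _ =>
          ((hFx.indicator measurableSet_Ioc).const_mul _).restrict
    _ ≤ _ := by
        refine Finset.sum_le_sum fun j _ => ?_
        rw [lintegral_const_mul'' _ (hFx.indicator measurableSet_Ioc).restrict]
        calc c j * ∫⁻ t in Ioc (-Real.pi) Real.pi, (W j).indicator (fun t => F (x + t)) t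
            ≤ c j * ∫⁻ t, (W j).indicator (fun t => F (x + t)) t := by
              gcongr; exact Measure.restrict_le_self
          _ = _ := by
              rw [lintegral_indicator measurableSet_Ioc, locAvg]
              simp only [c, div_eq_mul_inv]; ring

lemma eLpNorm_kerAvg_le {p : ℝ≥0∞} (hp : 1 ≤ p) {γ : ℝ → ℝ≥0∞} {C : ℝ≥0∞}
    (hC : AvgBounded p γ C) {n : ℕ} (hn : 1 ≤ n) {F : ℝ → ℝ≥0∞} (hF : AEMeasurable F)
    (hFp : Function.Periodic F (2 * Real.pi)) :
    eLpNorm (kerAvg n F) p (weightMeasure γ) ≤ 8 * C * eLpNorm F p (weightMeasure γ) := by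
  calc eLpNorm (kerAvg n F) p (weightMeasure γ)
      ≤ eLpNorm (∑ j ∈ Finset.range (n + 3),
          fun x => ENNReal.ofReal (4 / 2 ^ j) * locAvg (dyadicScale n j) F x) p
          (weightMeasure γ) := by
        refine eLpNorm_mono_enorm_ae (Filter.Eventually.of_forall fun x => ?_)
        simpa only [enorm_eq_self, Finset.sum_apply] using kerAvg_le_sum hn hF x
    _ ≤ ∑ j ∈ Finset.range (n + 3), eLpNorm
          (fun x => ENNReal.ofReal (4 / 2 ^ j) * locAvg (dyadicScale n j) F x) p
          (weightMeasure γ) :=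
        eLpNorm_sum_le (fun j _ =>
          ((measurable_locAvg hF _).const_mul _).aestronglyMeasurable) hp
    _ ≤ ∑ j ∈ Finset.range (n + 3), ENNReal.ofReal (4 / 2 ^ j) *
          (C * eLpNorm F p (weightMeasure γ)) := by
        refine Finset.sum_le_sum fun j _ => ?_
        refine (eLpNorm_le_nnreal_smul_eLpNorm_of_ae_le_mul' (c := (4 / 2 ^ j : ℝ).toNNReal)
          (g := locAvg (dyadicScale n j) F)
          (Filter.Eventually.of_forall fun x => ?_) p).trans ?_
        · simp [enorm_eq_self, ENNReal.ofReal]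
        · rw [ENNReal.smul_def, smul_eq_mul]
          exact mul_le_mul_right (hC F hF hFp _ (dyadicScale_pos hn j) (min_le_right _ _)) _
    _ = ENNReal.ofReal (∑ j ∈ Finset.range (n + 3), 4 / 2 ^ j) *
          (C * eLpNorm F p (weightMeasure γ)) := by
        rw [← Finset.sum_mul, ENNReal.ofReal_sum_of_nonneg fun _ _ => by positivity]
    _ ≤ ENNReal.ofReal 8 * (C * eLpNorm F p (weightMeasure γ)) := by
        gcongr
        have h : ∑ j ∈ Finset.range (n + 3), (4 : ℝ) / 2 ^ j =
            4 * ∑ j ∈ Finset.range (n + 3), (1 / 2 : ℝ) ^ j := by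
          rw [Finset.mul_sum]
          exact Finset.sum_congr rfl fun j _ => by rw [one_div, inv_pow]; ring
        rw [h]
        linarith [sum_geometric_two_le (n + 3)]
    _ = _ := by rw [ENNReal.ofReal_ofNat, mul_assoc]

/-! ### Symbols with two bounded derivatives -/

/-- `f` is twice differentiable at the points of `S`, and `f`, `f'` and `f''` are `O(w)` there. -/
def BddTwo (S : Set ℝ) (w : ℝ → ℝ) (f : ℝ → ℂ) : Prop :=
  ∃ f₁ f₂ : ℝ → ℂ, ∃ D : ℝ, 0 ≤ D ∧ ∀ t ∈ S, HasDerivAt f (f₁ t) t ∧ HasDerivAt f₁ (f₂ t) t ∧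
    ‖f t‖ ≤ D * w t ∧ ‖f₁ t‖ ≤ D * w t ∧ ‖f₂ t‖ ≤ D * w t

namespace BddTwo

variable {S : Set ℝ} {w : ℝ → ℝ} {f g : ℝ → ℂ}

lemma mul (hf : BddTwo S w f) (hg : BddTwo S 1 g) : BddTwo S w (fun t => f t * g t) := by
  obtain ⟨f₁, f₂, D, hD, hf⟩ := hf
  obtain ⟨g₁, g₂, E, hE, hg⟩ := hg
  refine ⟨fun t => f₁ t * g t + f t * g₁ t,
    fun t => (f₂ t * g t + f₁ t * g₁ t) + (f₁ t * g₁ t + f t * g₂ t), 4 * D * E, by positivity,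
    fun t ht => ?_⟩
  obtain ⟨a0, a1, b0, b1, b2⟩ := hf t ht
  obtain ⟨c0, c1, d0, d1, d2⟩ := hg t ht
  simp only [Pi.one_apply, mul_one] at d0 d1 d2
  have hw : 0 ≤ D * w t := (norm_nonneg _).trans b0
  have hb : ∀ {x y : ℂ}, ‖x‖ ≤ D * w t → ‖y‖ ≤ E → ‖x * y‖ ≤ D * w t * E := fun hx hy => by
    rw [norm_mul]; exact mul_le_mul hx hy (norm_nonneg _) hw
  have h0 : 0 ≤ D * w t * E := mul_nonneg hw hE
  refine ⟨a0.mul c0, (a1.mul c0).add (a0.mul c1), ?_, ?_, ?_⟩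
  · linarith [hb b0 d0]
  · linarith [norm_add_le (f₁ t * g t) (f t * g₁ t), hb b1 d0, hb b0 d1]
  · linarith [norm_add_le (f₂ t * g t + f₁ t * g₁ t) (f₁ t * g₁ t + f t * g₂ t),
      norm_add_le (f₂ t * g t) (f₁ t * g₁ t), norm_add_le (f₁ t * g₁ t) (f t * g₂ t),
      hb b2 d0, hb b1 d1, hb b0 d2]

lemma add (hf : BddTwo S w f) (hg : BddTwo S w g) : BddTwo S w (fun t => f t + g t) := by
  obtain ⟨f₁, f₂, D, hD, hf⟩ := hf
  obtain ⟨g₁, g₂, E, hE, hg⟩ := hg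
  refine ⟨fun t => f₁ t + g₁ t, fun t => f₂ t + g₂ t, D + E, by positivity, fun t ht => ?_⟩
  obtain ⟨a0, a1, b0, b1, b2⟩ := hf t ht
  obtain ⟨c0, c1, d0, d1, d2⟩ := hg t ht
  rw [add_mul]
  exact ⟨a0.add c0, a1.add c1, norm_add_le_of_le b0 d0, norm_add_le_of_le b1 d1,
    norm_add_le_of_le b2 d2⟩

lemma const (c : ℂ) : BddTwo S 1 (fun _ => c) :=
  ⟨fun _ => 0, fun _ => 0, ‖c‖, norm_nonneg _, fun t _ =>
    ⟨hasDerivAt_const _ _, hasDerivAt_const _ _, by simp⟩⟩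

lemma pow (hf : BddTwo S 1 f) (n : ℕ) : BddTwo S 1 (fun t => f t ^ n) := by
  induction n with
  | zero => simpa using const 1
  | succ n ih => simpa only [pow_succ] using ih.mul hf

lemma sum_range {F : ℕ → ℝ → ℂ} (hF : ∀ i, BddTwo S 1 (F i)) (n : ℕ) :
    BddTwo S 1 (fun t => ∑ i ∈ Finset.range n, F i t) := by
  induction n with
  | zero => simpa using const 0
  | succ n ih => simpa only [Finset.sum_range_succ] using ih.add (hF n)

lemma inv (hf : BddTwo S 1 f) {c : ℝ} (hc : 0 < c) (hfc : ∀ t ∈ S, c ≤ ‖f t‖) :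
    BddTwo S 1 (fun t => (f t)⁻¹) := by
  obtain ⟨f₁, f₂, D, hD, hf⟩ := hf
  refine ⟨fun t => -f₁ t / f t ^ 2,
    fun t => (-f₂ t * f t ^ 2 - -f₁ t * (2 * f t * f₁ t)) / (f t ^ 2) ^ 2,
    1 / c + D / c ^ 2 + (D * D ^ 2 + D * (2 * D * D)) / (c ^ 2) ^ 2, by positivity,
    fun t ht => ?_⟩
  obtain ⟨a0, a1, b0, b1, b2⟩ := hf t ht
  simp only [Pi.one_apply, mul_one] at b0 b1 b2 ⊢
  have hcf := hfc t ht
  have hne : f t ≠ 0 := norm_pos_iff.1 (hc.trans_le hcf)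
  have p1 : 0 ≤ 1 / c := by positivity
  have p2 : 0 ≤ D / c ^ 2 := by positivity
  have p3 : 0 ≤ (D * D ^ 2 + D * (2 * D * D)) / (c ^ 2) ^ 2 := by positivity
  have hsq : HasDerivAt (fun t => f t ^ 2) (2 * f t * f₁ t) t := by simpa using a0.fun_pow 2
  refine ⟨a0.inv hne, a1.neg.div hsq (pow_ne_zero 2 hne), ?_, ?_, ?_⟩
  · have : ‖(f t)⁻¹‖ ≤ 1 / c := by rw [norm_inv, one_div]; gcongr
    linarith
  · have : ‖-f₁ t / f t ^ 2‖ ≤ D / c ^ 2 := by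
      rw [norm_div, norm_neg, norm_pow]; gcongr
    linarith
  · have : ‖(-f₂ t * f t ^ 2 - -f₁ t * (2 * f t * f₁ t)) / (f t ^ 2) ^ 2‖ ≤
        (D * D ^ 2 + D * (2 * D * D)) / (c ^ 2) ^ 2 := by
      rw [norm_div, norm_pow, norm_pow]
      gcongr
      refine (norm_sub_le _ _).trans ?_
      simp only [norm_mul, norm_neg, norm_pow, Complex.norm_ofNat]
      gcongr
    linarith

lemma congr (hf : BddTwo S w f) (hS : IsOpen S) (h : ∀ t ∈ S, g t = f t) : BddTwo S w g := by
  obtain ⟨f₁, f₂, D, hD, hf⟩ := hf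
  refine ⟨f₁, f₂, D, hD, fun t ht => ?_⟩
  obtain ⟨a0, a1, b0, b1, b2⟩ := hf t ht
  refine ⟨a0.congr_of_eventuallyEq ?_, a1, by rwa [h t ht], b1, b2⟩
  filter_upwards [hS.mem_nhds ht] with s hs using h s hs

/-- A function that vanishes on an open set inherits global bounds from the complement. -/
lemma univ_of_zero {U : Set ℝ} (hf : BddTwo S w f) (hS : IsOpen S) (hU : IsOpen U)
    (hUS : S ∪ U = univ) (hw : ∀ t, 0 ≤ w t) (h0 : ∀ t ∈ U, f t = 0) : BddTwo univ w f := by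
  obtain ⟨f₁, f₂, D, hD, hf⟩ := hf
  have hSd : ∀ t ∈ S, deriv f t = f₁ t := fun t ht => (hf t ht).1.deriv
  have hUz : ∀ t ∈ U, f =ᶠ[nhds t] fun _ => 0 := fun t ht => by
    filter_upwards [hU.mem_nhds ht] with s hs using h0 s hs
  refine ⟨deriv f, deriv (deriv f), D, hD, fun t _ => ?_⟩
  rcases (hUS ▸ mem_univ t : t ∈ S ∪ U) with ht | ht
  · obtain ⟨a0, a1, b0, b1, b2⟩ := hf t ht
    have hd : HasDerivAt (deriv f) (f₂ t) t := a1.congr_of_eventuallyEq (by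
      filter_upwards [hS.mem_nhds ht] with s hs using hSd s hs)
    rw [hd.deriv, hSd t ht]
    exact ⟨a0, hd, b0, b1, b2⟩
  · have h1 := hUz t ht
    have h2 : deriv f =ᶠ[nhds t] fun _ => 0 := by simpa using h1.deriv
    have h3 : deriv (deriv f) t = 0 := by simpa using h2.deriv_eq
    have hp := mul_nonneg hD (hw t)
    rw [h3, h2.eq_of_nhds, h1.eq_of_nhds]
    simp only [norm_zero]
    exact ⟨(hasDerivAt_const _ _).congr_of_eventuallyEq h1,
      (hasDerivAt_const _ _).congr_of_eventuallyEq h2, hp, hp, hp⟩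

end BddTwo

lemma bddTwo_cexp (S : Set ℝ) : BddTwo S 1 (fun t : ℝ => Complex.exp (Complex.I * t)) := by
  have hd : ∀ t : ℝ, HasDerivAt (fun t : ℝ => Complex.exp (Complex.I * t))
      (Complex.I * Complex.exp (Complex.I * t)) t := fun t => by
    have := ((hasDerivAt_id t).ofReal_comp.const_mul Complex.I).cexp
    simpa [mul_comm] using this
  have hn : ∀ t : ℝ, ‖Complex.exp (Complex.I * t)‖ = 1 := fun t => by
    rw [mul_comm]; exact Complex.norm_exp_ofReal_mul_I t
  refine ⟨_, _, 1, zero_le_one, fun t _ => ⟨hd t, (hd t).const_mul Complex.I, ?_⟩⟩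
  simp [hn]

lemma bddTwo_inv : BddTwo {t : ℝ | 1 / 4 < |t|} 1 (fun t : ℝ => ((t : ℂ))⁻¹) := by
  refine ⟨fun t => -1 / (t : ℂ) ^ 2, fun t => 2 / (t : ℂ) ^ 3, 128, by norm_num, fun t ht => ?_⟩
  have ht4 : 1 / 4 < |t| := ht
  have h0 : t ≠ 0 := abs_pos.1 (lt_trans (by norm_num) ht4)
  have hc : (t : ℂ) ≠ 0 := by exact_mod_cast h0
  have hd : HasDerivAt (fun t : ℝ => (t : ℂ)) 1 t := by
    simpa using (hasDerivAt_id t).ofReal_comp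
  refine ⟨by simpa using hd.fun_inv hc, ?_, ?_, ?_, ?_⟩
  · have h2 : HasDerivAt (fun t : ℝ => (t : ℂ) ^ 2) (2 * t) t := by simpa using hd.fun_pow 2
    have := (hasDerivAt_const t (-1 : ℂ)).div h2 (pow_ne_zero 2 hc)
    convert! this using 1
    field_simp
    ring
  · simp only [norm_inv, Complex.norm_real, Real.norm_eq_abs, Pi.one_apply]
    calc |t|⁻¹ ≤ (1 / 4)⁻¹ := by gcongr
      _ ≤ _ := by norm_num
  · simp only [norm_div, norm_neg, norm_one, norm_pow, Complex.norm_real, Real.norm_eq_abs,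
      Pi.one_apply]
    calc 1 / |t| ^ 2 ≤ 1 / (1 / 4) ^ 2 := by gcongr
      _ ≤ _ := by norm_num
  · simp only [norm_div, Complex.norm_ofNat, norm_pow, Complex.norm_real, Real.norm_eq_abs,
      Pi.one_apply]
    calc 2 / |t| ^ 3 ≤ 2 / (1 / 4) ^ 3 := by gcongr
      _ ≤ _ := by norm_num

lemma bddTwo_inv_sq :
    BddTwo {t : ℝ | 1 / 4 < |t|} (fun t => 1 / (1 + t ^ 2)) (fun t : ℝ => ((t : ℂ) ^ 2)⁻¹) := by
  refine ⟨fun t => -2 / (t : ℂ) ^ 3, fun t => 6 / (t : ℂ) ^ 4, 1632, by norm_num,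
    fun t ht => ?_⟩
  have ht4 : 1 / 4 < |t| := ht
  have h0 : t ≠ 0 := abs_pos.1 (lt_trans (by norm_num) ht4)
  have hc : (t : ℂ) ≠ 0 := by exact_mod_cast h0
  have hd : HasDerivAt (fun t : ℝ => (t : ℂ)) 1 t := by
    simpa using (hasDerivAt_id t).ofReal_comp
  have h2 : HasDerivAt (fun t : ℝ => (t : ℂ) ^ 2) (2 * t) t := by simpa using hd.fun_pow 2
  have h3 : HasDerivAt (fun t : ℝ => (t : ℂ) ^ 3) (3 * (t : ℂ) ^ 2) t := by simpa using hd.fun_pow 3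
  have hsq : 1 / 16 < |t| ^ 2 := by nlinarith
  have key : 1 / |t| ^ 2 ≤ 17 * (1 / (1 + t ^ 2)) := by
    rw [← sq_abs t, mul_one_div, div_le_div_iff₀ (by positivity) (by positivity)]
    linarith
  refine ⟨?_, ?_, ?_, ?_, ?_⟩
  · convert! h2.inv (pow_ne_zero 2 hc) using 1
    field_simp
  · convert! (hasDerivAt_const t (-2 : ℂ)).div h3 (pow_ne_zero 3 hc) using 1
    field_simp
    ring
  · simp only [norm_inv, norm_pow, Complex.norm_real, Real.norm_eq_abs]
    rw [← one_div]
    have : 0 ≤ 1 / (1 + t ^ 2) := by positivity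
    linarith
  · simp only [norm_div, norm_neg, Complex.norm_ofNat, norm_pow, Complex.norm_real,
      Real.norm_eq_abs]
    calc 2 / |t| ^ 3 = 2 / |t| * (1 / |t| ^ 2) := by field_simp
      _ ≤ 2 / (1 / 4) * (17 * (1 / (1 + t ^ 2))) := by gcongr
      _ ≤ _ := by
        have : 0 ≤ 1 / (1 + t ^ 2) := by positivity
        linarith
  · simp only [norm_div, Complex.norm_ofNat, norm_pow, Complex.norm_real, Real.norm_eq_abs]
    calc 6 / |t| ^ 4 = 6 / |t| ^ 2 * (1 / |t| ^ 2) := by field_simp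
      _ ≤ 6 / (1 / 16) * (17 * (1 / (1 + t ^ 2))) := by gcongr
      _ ≤ _ := by
        have : 0 ≤ 1 / (1 + t ^ 2) := by positivity
        linarith

/-! ### The symbol of the Steklov mean -/

/-- The Fourier symbol `m(t) = ∫₀¹ exp(i t s) ds`: the mean `𝔗_v` multiplies the `k`-th Fourier
coefficient by `m(k v)`. -/
def steklovSymbol (t : ℝ) : ℂ := ∫ s in (0 : ℝ)..1, Complex.exp (Complex.I * t * s)

lemma steklovSymbol_eq {t : ℝ} (ht : t ≠ 0) :
    steklovSymbol t = (Complex.exp (Complex.I * t) - 1) * (-Complex.I) * (t : ℂ)⁻¹ := by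
  have hc : Complex.I * (t : ℂ) ≠ 0 := mul_ne_zero Complex.I_ne_zero (by exact_mod_cast ht)
  have ht' : (t : ℂ) ≠ 0 := by exact_mod_cast ht
  rw [steklovSymbol, integral_exp_mul_complex hc]
  simp only [Complex.ofReal_one, mul_one, Complex.ofReal_zero, mul_zero, Complex.exp_zero]
  field_simp
  simp

lemma steklovSymbol_re {t : ℝ} (ht : t ≠ 0) : (steklovSymbol t).re = Real.sin t / t := by
  rw [steklovSymbol_eq ht, ← Complex.ofReal_inv, Complex.re_mul_ofReal, mul_comm Complex.I,
    Complex.exp_mul_I, ← Complex.ofReal_cos, ← Complex.ofReal_sin]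
  simp only [Complex.mul_re, Complex.neg_re, Complex.I_re, Complex.neg_im, Complex.I_im,
    Complex.sub_im, Complex.add_im, Complex.ofReal_im, Complex.mul_im, Complex.ofReal_re,
    Complex.one_im, div_eq_mul_inv]
  ring

/-- The real part `sin t / t` of the symbol stays away from `1`: by compactness on `[1/4, 4]`, and
by decay beyond. -/
lemma exists_le_norm_one_sub_steklovSymbol :
    ∃ c : ℝ, 0 < c ∧ ∀ t : ℝ, 1 / 4 < |t| → c ≤ ‖1 - steklovSymbol t‖ := by
  have hcont : ContinuousOn (fun t : ℝ => 1 - Real.sin t / t) (Icc (1 / 4) 4) :=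
    continuousOn_const.sub (Real.continuous_sin.continuousOn.div continuousOn_id
      fun t ht => (show (0 : ℝ) < t by linarith [ht.1]).ne')
  obtain ⟨t₀, ht₀, hmin⟩ := isCompact_Icc.exists_isMinOn (nonempty_Icc.2 (by norm_num)) hcont
  have hpos : 0 < 1 - Real.sin t₀ / t₀ := by
    have h1 : 0 < t₀ := by linarith [ht₀.1]
    rw [sub_pos, div_lt_one h1]
    exact Real.sin_lt h1
  have habs : ∀ t : ℝ, 1 / 4 < t → min (1 - Real.sin t₀ / t₀) (1 / 2) ≤ 1 - Real.sin t / t := by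
    intro t ht
    rcases le_or_gt t 4 with h | h
    · exact (min_le_left _ _).trans (hmin ⟨ht.le, h⟩)
    · refine (min_le_right _ _).trans ?_
      have : Real.sin t / t ≤ 1 / 2 := by
        rw [div_le_iff₀ (by linarith)]
        linarith [Real.sin_le_one t]
      linarith
  refine ⟨min (1 - Real.sin t₀ / t₀) (1 / 2), lt_min hpos (by norm_num), fun t ht => ?_⟩
  have h0 : t ≠ 0 := abs_pos.1 (lt_trans (by norm_num) ht)
  have heven : Real.sin |t| / |t| = Real.sin t / t := by
    rcases abs_choice t with h | h <;> rw [h]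
    rw [Real.sin_neg, neg_div_neg_eq]
  calc min (1 - Real.sin t₀ / t₀) (1 / 2) ≤ 1 - Real.sin |t| / |t| := habs _ ht
    _ = (1 - steklovSymbol t).re := by rw [heven, Complex.sub_re, steklovSymbol_re h0]; simp
    _ ≤ ‖1 - steklovSymbol t‖ := Complex.re_le_norm _

/-- A smooth even cutoff, equal to `1` on `[-1/2, 1/2]` and supported in `[-1, 1]`. -/
def cutoff : ContDiffBump (0 : ℝ) where
  rIn := 1 / 2
  rOut := 1
  rIn_pos := by norm_num
  rIn_lt_rOut := by norm_num

lemma cutoff_eq_one {t : ℝ} (ht : |t| ≤ 1 / 2) : cutoff t = 1 :=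
  cutoff.one_of_mem_closedBall (by simpa [cutoff] using ht)

lemma cutoff_eq_zero {t : ℝ} (ht : 1 ≤ |t|) : cutoff t = 0 :=
  cutoff.zero_of_le_dist (by simpa [cutoff] using ht)

lemma bddTwo_cutoff (S : Set ℝ) : BddTwo S 1 (fun t => ((cutoff t : ℝ) : ℂ)) := by
  have hs : ContDiff ℝ 2 cutoff := cutoff.contDiff
  have hs1 : ContDiff ℝ 1 (deriv cutoff) := by
    have : ContDiff ℝ (1 + 1) cutoff := by simpa [one_add_one_eq_two] using hs
    exact (contDiff_succ_iff_deriv.1 this).2.2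
  have hs2 : Continuous (deriv (deriv cutoff)) := hs1.continuous_deriv le_rfl
  have hc := cutoff.hasCompactSupport
  obtain ⟨A, hA⟩ := hc.exists_bound_of_continuous hs.continuous
  obtain ⟨B, hB⟩ := hc.deriv.exists_bound_of_continuous hs1.continuous
  obtain ⟨C, hC⟩ := hc.deriv.deriv.exists_bound_of_continuous hs2
  refine ⟨fun t => ((deriv cutoff t : ℝ) : ℂ), fun t => ((deriv (deriv cutoff) t : ℝ) : ℂ),
    max A (max B C), le_max_of_le_left ((norm_nonneg _).trans (hA 0)), fun t _ => ?_⟩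
  simp only [Pi.one_apply, mul_one, Complex.norm_real]
  exact ⟨((hs.differentiable (by norm_num)) t).hasDerivAt.ofReal_comp,
    ((hs1.differentiable (by norm_num)) t).hasDerivAt.ofReal_comp,
    (hA t).trans (le_max_left _ _), (hB t).trans (le_max_of_le_right (le_max_left _ _)),
    (hC t).trans (le_max_of_le_right (le_max_right _ _))⟩

/-- The symbol of the operator that recovers the high frequencies of
`(I - (I - 𝔗_v)^r)² f` from `(I - 𝔗_v)^r f`. -/
def jacksonSymbol (r : ℕ) (t : ℝ) : ℂ :=
  (1 - (cutoff t : ℝ)) * (1 - (1 - steklovSymbol t) ^ r) ^ 2 / (1 - steklovSymbol t) ^ r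

/-- The defining relation of the symbol. It holds at the origin too, where the denominator may
vanish, because the factor `1 - η` is zero there. -/
lemma jacksonSymbol_mul (r : ℕ) (t : ℝ) :
    jacksonSymbol r t * (1 - steklovSymbol t) ^ r =
      (1 - (cutoff t : ℝ)) * (1 - (1 - steklovSymbol t) ^ r) ^ 2 := by
  rcases le_or_gt |t| (1 / 2) with h | h
  · simp [jacksonSymbol, cutoff_eq_one h]
  · obtain ⟨c, hc, H⟩ := exists_le_norm_one_sub_steklovSymbol
    have hne : 1 - steklovSymbol t ≠ 0 :=
      norm_pos_iff.1 (hc.trans_le (H t (by linarith)))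
    rw [jacksonSymbol, div_mul_cancel₀ _ (pow_ne_zero r hne)]

/-- The Jackson symbol decays like `t⁻²` together with two derivatives: away from the origin
`1 - (1 - m)^r` is `t⁻¹` times a symbol with bounded derivatives. -/
lemma bddTwo_jacksonSymbol (r : ℕ) :
    BddTwo univ (fun t => 1 / (1 + t ^ 2)) (jacksonSymbol r) := by
  -- The cutoff is `1` for `|t| ≤ 1/2`, so the open sets `1/4 < |t|` and `|t| < 1/2` cover the line.
  set S : Set ℝ := {t | 1 / 4 < |t|}
  have hS : IsOpen S := isOpen_lt continuous_const continuous_abs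
  have h0 : ∀ t ∈ S, t ≠ 0 := fun t ht => abs_pos.1 (lt_trans (by norm_num) (mem_ofPred_eq ▸ ht))
  have hE : BddTwo S 1 (fun t : ℝ => (Complex.exp (Complex.I * t) - 1) * (-Complex.I)) := by
    simpa only [sub_eq_add_neg] using ((bddTwo_cexp S).add (.const (-1))).mul (.const (-Complex.I))
  have hX : BddTwo S 1 (fun t => 1 - steklovSymbol t) := by
    have h := (BddTwo.const (S := S) 1).add ((BddTwo.const (-1)).mul (hE.mul bddTwo_inv))
    exact h.congr hS fun t ht => by rw [steklovSymbol_eq (h0 t ht)]; ring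
  obtain ⟨c, hc, H⟩ := exists_le_norm_one_sub_steklovSymbol
  have hη : BddTwo S 1 (fun t => 1 - ((cutoff t : ℝ) : ℂ)) := by
    have h := (BddTwo.const (S := S) 1).add ((BddTwo.const (-1)).mul (bddTwo_cutoff S))
    exact h.congr hS fun t _ => by ring
  have hinv : BddTwo S 1 (fun t => ((1 - steklovSymbol t) ^ r)⁻¹) :=
    (hX.pow r).inv (pow_pos hc r) fun t ht => by
      rw [norm_pow]; exact pow_le_pow_left₀ hc.le (H t ht) r
  have hq : BddTwo S 1 (fun t => ∑ i ∈ Finset.range r, (1 - steklovSymbol t) ^ i) :=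
    BddTwo.sum_range (fun i => hX.pow i) r
  have htot := bddTwo_inv_sq.mul ((((hE.pow 2).mul (hq.pow 2)).mul hη).mul hinv)
  refine (htot.congr hS fun t ht => ?_).univ_of_zero hS
    (isOpen_lt continuous_abs continuous_const : IsOpen {t : ℝ | |t| < 1 / 2}) ?_
    (fun t => by positivity) fun t ht => ?_
  · have hgeom := mul_neg_geom_sum (1 - steklovSymbol t) r
    rw [sub_sub_cancel] at hgeom
    have hm := steklovSymbol_eq (h0 t ht)
    rw [jacksonSymbol, ← hgeom, div_eq_mul_inv]
    nth_rewrite 1 [hm]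
    rw [← inv_pow]
    ring
  · refine eq_univ_of_forall fun t => ?_
    rcases lt_or_ge |t| (1 / 2) with h | h
    · exact Or.inr h
    · exact Or.inl (lt_of_lt_of_le (by norm_num) h)
  · have ht' : |t| < 1 / 2 := ht
    simp [jacksonSymbol, cutoff_eq_one ht'.le]

/-! ### Kernels of smooth symbols -/

/-- The character `e^{ikx}`. -/
def expChar (k : ℤ) (x : ℝ) : ℂ := Complex.exp (((k * x : ℝ) : ℂ) * Complex.I)

lemma norm_expChar (k : ℤ) (x : ℝ) : ‖expChar k x‖ = 1 := Complex.norm_exp_ofReal_mul_I _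

lemma expChar_add_arg (k : ℤ) (x y : ℝ) : expChar k (x + y) = expChar k x * expChar k y := by
  rw [expChar, expChar, expChar, ← Complex.exp_add]; congr 1; push_cast; ring

lemma expChar_add (j k : ℤ) (x : ℝ) : expChar (j + k) x = expChar j x * expChar k x := by
  rw [expChar, expChar, expChar, ← Complex.exp_add]; congr 1; push_cast; ring

lemma expChar_neg_mul (k : ℤ) (x : ℝ) : expChar (-k) x * expChar k x = 1 := by
  rw [← expChar_add]; simp [expChar]

lemma expChar_neg_arg (k : ℤ) (x : ℝ) : expChar k (-x) = expChar (-k) x := by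
  simp [expChar]

lemma expChar_periodic (k : ℤ) : Function.Periodic (expChar k) (2 * Real.pi) := fun x => by
  rw [expChar_add_arg]
  have : expChar k (2 * Real.pi) = 1 := by
    rw [expChar, Complex.exp_eq_one_iff]; exact ⟨k, by push_cast; ring⟩
  rw [this, mul_one]

lemma continuous_expChar (k : ℤ) : Continuous (expChar k) := by
  unfold expChar; fun_prop

/-- The sequence `1 / (1 + (k / n)²)` has sum of order `n`, by comparison with a telescoping
series. -/
lemma summable_weight {n : ℕ} (hn : 1 ≤ n) :
    Summable (fun k : ℤ => 1 / (1 + ((k : ℝ) / n) ^ 2)) ∧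
      ∑' k : ℤ, 1 / (1 + ((k : ℝ) / n) ^ 2) ≤ 8 * (n : ℝ) := by
  have hn0 : (0 : ℝ) < n := by exact_mod_cast hn
  set f : ℤ → ℝ := fun k => 1 / (1 + ((k : ℝ) / n) ^ 2) with hf
  have hpos : ∀ k, 0 ≤ f k := fun k => by simp only [hf]; positivity
  have hle : ∀ k : ℕ, f k ≤ 4 * n ^ 2 * (1 / (n + k : ℝ) - 1 / (n + (k + 1 : ℕ) : ℝ)) := by
    intro k
    have hk : (0 : ℝ) ≤ k := k.cast_nonneg
    have e : 4 * (n : ℝ) ^ 2 * (1 / (n + k : ℝ) - 1 / (n + (k + 1 : ℕ) : ℝ)) =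
        4 * n ^ 2 / ((n + k) * (n + k + 1)) := by
      push_cast; field_simp; ring
    have e' : f k = n ^ 2 / (n ^ 2 + k ^ 2) := by
      simp only [hf, Int.cast_natCast]; field_simp
    have h1 : (1 : ℝ) ≤ n := by exact_mod_cast hn
    rw [e, e', div_le_div_iff₀ (by positivity) (by positivity)]
    have : ((n : ℝ) + k) * (n + k + 1) ≤ 4 * (n ^ 2 + k ^ 2) := by
      nlinarith [sq_nonneg ((n : ℝ) - k)]
    nlinarith [sq_nonneg (n : ℝ)]
  have hle' : ∀ k : ℕ, f (-(k + 1)) ≤ f k := by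
    intro k
    have hk : (0 : ℝ) ≤ k := k.cast_nonneg
    have : (((k : ℕ) : ℤ) / n : ℝ) ^ 2 ≤ (((-(k + 1) : ℤ) : ℝ) / n) ^ 2 := by
      push_cast
      rw [div_pow, div_pow]
      gcongr ?_ / _
      nlinarith
    simp only [hf]
    gcongr
  have hpart : ∀ N, ∑ k ∈ Finset.range N, f k ≤ 4 * n := by
    intro N
    calc ∑ k ∈ Finset.range N, f k ≤ ∑ k ∈ Finset.range N,
          4 * (n : ℝ) ^ 2 * (1 / (n + k : ℝ) - 1 / (n + (k + 1 : ℕ) : ℝ)) :=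
          Finset.sum_le_sum fun k _ => hle k
      _ = 4 * n ^ 2 * (1 / (n + (0 : ℕ)) - 1 / (n + N)) := by
          rw [← Finset.mul_sum, Finset.sum_range_sub' (fun k : ℕ => 1 / (n + k : ℝ))]
      _ ≤ 4 * n ^ 2 * (1 / n) := by
          have : (0 : ℝ) ≤ 1 / (n + N) := by positivity
          gcongr
          simp only [Nat.cast_zero, add_zero]
          linarith
      _ = 4 * n := by field_simp
  have hpart' : ∀ N, ∑ k ∈ Finset.range N, f (-(k + 1)) ≤ 4 * n := fun N =>
    (Finset.sum_le_sum fun k _ => hle' k).trans (hpart N)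
  have s1 := summable_of_sum_range_le (fun k : ℕ => hpos k) hpart
  have s2 := summable_of_sum_range_le (fun k : ℕ => hpos (-(k + 1))) hpart'
  have hs := s1.hasSum.of_nat_of_neg_add_one s2.hasSum
  refine ⟨hs.summable, ?_⟩
  rw [hs.tsum_eq]
  linarith [Real.tsum_le_of_sum_range_le (fun k : ℕ => hpos k) hpart,
    Real.tsum_le_of_sum_range_le (fun k : ℕ => hpos (-(k + 1))) hpart']

lemma norm_second_difference_le {f f₁ f₂ : ℝ → ℂ} (h1 : ∀ t, HasDerivAt f (f₁ t) t)
    (h2 : ∀ t, HasDerivAt f₁ (f₂ t) t) {t v M : ℝ} (hv : 0 ≤ v)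
    (hM : ∀ s, |s - t| ≤ v → ‖f₂ s‖ ≤ M) :
    ‖f (t + v) + f (t - v) - 2 * f t‖ ≤ 2 * M * v ^ 2 := by
  have hd1 : ∀ s ∈ Icc 0 v, ‖f₁ (t + s) - f₁ (t - s)‖ ≤ M * (2 * v) := by
    intro s hs
    have := (convex_Icc (t - v) (t + v)).norm_image_sub_le_of_norm_hasDerivWithin_le
      (f := f₁) (f' := f₂) (C := M) (x := t - s) (y := t + s)
      (fun x _ => (h2 x).hasDerivWithinAt)
      (fun x hx => hM x (abs_le.2 ⟨by linarith [hx.1], by linarith [hx.2]⟩))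
      ⟨by linarith [hs.2], by linarith [hs.1]⟩ ⟨by linarith [hs.1], by linarith [hs.2]⟩
    refine this.trans ?_
    have hM0 : 0 ≤ M := (norm_nonneg _).trans (hM t (by simpa using hv))
    gcongr
    rw [Real.norm_eq_abs, show t + s - (t - s) = 2 * s by ring, abs_of_nonneg (by linarith [hs.1])]
    linarith [hs.2]
  have hd : ∀ s, HasDerivAt (fun s => f (t + s) + f (t - s)) (f₁ (t + s) - f₁ (t - s)) s := by
    intro s
    have a := (h1 (t + s)).scomp s ((hasDerivAt_id s).const_add t)
    have b := (h1 (t - s)).scomp s ((hasDerivAt_id s).const_sub t)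
    convert! a.add b using 1
    simp [sub_eq_add_neg]
  have := (convex_Icc 0 v).norm_image_sub_le_of_norm_hasDerivWithin_le
    (f := fun s => f (t + s) + f (t - s)) (C := M * (2 * v)) (x := 0) (y := v)
    (fun x _ => (hd x).hasDerivWithinAt) hd1 ⟨le_rfl, hv⟩ ⟨hv, le_rfl⟩
  simp only [add_zero, sub_zero, Real.norm_eq_abs, abs_of_nonneg hv] at this
  rw [two_mul (f t)]
  linarith

/-- Summation by parts, twice. -/
lemma tsum_second_difference {a : ℤ → ℂ} (hsa : Summable (fun k => ‖a k‖)) (x : ℝ) :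
    (2 * Real.cos x - 2 : ℝ) * ∑' k, a k * expChar k x =
      ∑' k, (a (k + 1) + a (k - 1) - 2 * a k) * expChar k x := by
  have hs : ∀ b : ℤ → ℂ, Summable (fun k => ‖b k‖) → Summable (fun k => b k * expChar k x) :=
    fun b hb => Summable.of_norm (by simpa only [norm_mul, norm_expChar, mul_one] using hb)
  have hp : Summable (fun k : ℤ => a (k + 1) * expChar k x) :=
    hs (fun k => a (k + 1)) (hsa.comp_injective (add_left_injective (1 : ℤ)))
  have hm : Summable (fun k : ℤ => a (k - 1) * expChar k x) :=
    hs (fun k => a (k - 1)) (hsa.comp_injective (sub_left_injective (b := (1 : ℤ))))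
  have tp : ∑' k : ℤ, a (k + 1) * expChar k x = expChar (-1) x * ∑' k, a k * expChar k x := by
    rw [← (Equiv.addRight (1 : ℤ)).tsum_eq (fun k => a k * expChar k x), ← tsum_mul_left]
    refine tsum_congr fun k => ?_
    rw [Equiv.coe_addRight, expChar_add]
    linear_combination (-(a (k + 1) * expChar k x)) * expChar_neg_mul 1 x
  have tm : ∑' k : ℤ, a (k - 1) * expChar k x = expChar 1 x * ∑' k, a k * expChar k x := by
    rw [← (Equiv.subRight (1 : ℤ)).tsum_eq (fun k => a k * expChar k x), ← tsum_mul_left]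
    refine tsum_congr fun k => ?_
    rw [Equiv.subRight_apply, sub_eq_add_neg k 1, expChar_add]
    linear_combination (-(a (k + -1) * expChar k x)) * expChar_neg_mul 1 x
  have hcos : ((2 * Real.cos x - 2 : ℝ) : ℂ) = expChar (-1) x + expChar 1 x - 2 := by
    simp only [expChar]
    push_cast
    rw [Complex.two_cos]
    simp only [one_mul, neg_mul]
    ring
  rw [hcos, sub_mul, add_mul, ← tp, ← tm, ← tsum_mul_left, ← hp.tsum_add hm,
    ← (hp.add hm).tsum_sub ((hs a hsa).mul_left 2)]
  exact tsum_congr fun k => by ring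

/-- The kernel with Fourier coefficients `ψ(k / n)`. -/
def symbolKernel (ψ : ℝ → ℂ) (n : ℕ) (x : ℝ) : ℂ :=
  ∑' k : ℤ, ψ ((k : ℝ) / n) * expChar k x

lemma summable_norm_symbol {ψ : ℝ → ℂ} (hψ : BddTwo univ (fun t => 1 / (1 + t ^ 2)) ψ)
    {n : ℕ} (hn : 1 ≤ n) : Summable (fun k : ℤ => ‖ψ ((k : ℝ) / n)‖) := by
  obtain ⟨ψ₁, ψ₂, D, hD, h⟩ := hψ
  exact Summable.of_nonneg_of_le (fun _ => norm_nonneg _) (fun k => (h _ trivial).2.2.1)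
    ((summable_weight hn).1.mul_left D)

/-- A symbol that is `O(t⁻²)` with its first two derivatives gives kernels dominated by the model
kernel: the size of the kernel comes from summing the coefficients, its decay from summing their
second differences. -/
lemma exists_norm_symbolKernel_le {ψ : ℝ → ℂ}
    (hψ : BddTwo univ (fun t => 1 / (1 + t ^ 2)) ψ) :
    ∃ C : ℝ, 0 ≤ C ∧ ∀ n : ℕ, 1 ≤ n → ∀ x : ℝ, |x| ≤ Real.pi →
      ‖symbolKernel ψ n x‖ ≤ C * kerMajorant n x := by
  have hsum := fun (n : ℕ) (hn : 1 ≤ n) => summable_norm_symbol hψ hn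
  obtain ⟨ψ₁, ψ₂, D, hD, h⟩ := hψ
  -- `128 = 8 + 120`: the bounds `8 D n` for the kernel and `120 D / n` for `x²` times the kernel.
  refine ⟨128 * D, by positivity, fun n hn x hx => ?_⟩
  have hn0 : (0 : ℝ) < n := by exact_mod_cast hn
  have hn1 : (1 : ℝ) ≤ n := by exact_mod_cast hn
  obtain ⟨hw, hwle⟩ := summable_weight hn
  set w : ℤ → ℝ := fun k => 1 / (1 + ((k : ℝ) / n) ^ 2) with hwdef
  set a : ℤ → ℂ := fun k => ψ ((k : ℝ) / n) with ha
  have hsa : Summable (fun k => ‖a k‖) := hsum n hn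
  have hnorm : ∀ b : ℤ → ℂ, ∀ E : ℝ, (∀ k, ‖b k‖ ≤ E * w k) →
      ‖∑' k, b k * expChar k x‖ ≤ E * ∑' k, w k := by
    intro b E hb
    refine tsum_of_norm_bounded (hw.hasSum.mul_left E) fun k => ?_
    rw [norm_mul, norm_expChar, mul_one]
    exact hb k
  have hsize : ‖symbolKernel ψ n x‖ ≤ D * (8 * n) :=
    (hnorm a D fun k => (h _ trivial).2.2.1).trans (by gcongr)
  set d : ℤ → ℂ := fun k => a (k + 1) + a (k - 1) - 2 * a k with hd
  have hdle : ∀ k, ‖d k‖ ≤ (6 * D / n ^ 2) * w k := by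
    intro k
    have e1 : ((k + 1 : ℤ) : ℝ) / n = k / n + 1 / n := by push_cast; ring
    have e2 : ((k - 1 : ℤ) : ℝ) / n = k / n - 1 / n := by push_cast; ring
    have hbd := norm_second_difference_le (f := ψ) (fun t => (h t trivial).1)
      (fun t => (h t trivial).2.1) (t := (k : ℝ) / n) (v := 1 / n) (M := 3 * D * w k)
      (by positivity) (fun s hs => by
        refine (h s trivial).2.2.2.2.trans ?_
        have hs1 : |s - (k : ℝ) / n| ≤ 1 := hs.trans (by rw [div_le_one hn0]; exact hn1)
        have h3 : 1 / (1 + s ^ 2) ≤ 3 * w k := by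
          simp only [hwdef]
          rw [mul_one_div, div_le_div_iff₀ (by positivity) (by positivity)]
          nlinarith [abs_le.1 hs1, sq_nonneg (s + (s - (k : ℝ) / n)), sq_abs (s - (k : ℝ) / n),
            abs_nonneg (s - (k : ℝ) / n)]
        calc D * (1 / (1 + s ^ 2)) ≤ D * (3 * w k) := by gcongr
          _ = _ := by ring)
    simp only [hd, ha, e1, e2]
    refine hbd.trans (le_of_eq ?_)
    field_simp
    ring
  have hdiff : (2 * Real.cos x - 2 : ℝ) * symbolKernel ψ n x = ∑' k, d k * expChar k x :=
    tsum_second_difference hsa x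
  have hdecay : ‖symbolKernel ψ n x‖ * x ^ 2 ≤ 120 * D / n := by
    have hcos : 4 / Real.pi ^ 2 * x ^ 2 ≤ |2 * Real.cos x - 2| := by
      have := Real.cos_le_one_sub_mul_cos_sq hx
      rw [abs_sub_comm]
      refine le_trans ?_ (le_abs_self _)
      calc 4 / Real.pi ^ 2 * x ^ 2 = 2 * (2 / Real.pi ^ 2 * x ^ 2) := by ring
        _ ≤ _ := by linarith
    have h1 := hnorm d _ hdle
    rw [← hdiff, norm_mul, Complex.norm_real, Real.norm_eq_abs] at h1
    have h2 : (6 * D / n ^ 2) * ∑' k, w k ≤ 48 * D / n := by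
      calc (6 * D / n ^ 2) * ∑' k, w k ≤ (6 * D / n ^ 2) * (8 * n) := by gcongr
        _ = _ := by field_simp; ring
    have h3 : 4 / Real.pi ^ 2 * x ^ 2 * ‖symbolKernel ψ n x‖ ≤ 48 * D / n :=
      le_trans (by gcongr) (h1.trans h2)
    have hpi : Real.pi ^ 2 ≤ 10 := by nlinarith [Real.pi_lt_d2, Real.pi_pos]
    calc ‖symbolKernel ψ n x‖ * x ^ 2
        = Real.pi ^ 2 / 4 * (4 / Real.pi ^ 2 * x ^ 2 * ‖symbolKernel ψ n x‖) := by
          field_simp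
      _ ≤ 10 / 4 * (48 * D / n) := by gcongr
      _ = _ := by ring
  rw [kerMajorant, mul_div_assoc', le_div_iff₀ (by positivity)]
  calc ‖symbolKernel ψ n x‖ * (1 + (n * x) ^ 2)
      = ‖symbolKernel ψ n x‖ + n ^ 2 * (‖symbolKernel ψ n x‖ * x ^ 2) := by ring
    _ ≤ D * (8 * n) + n ^ 2 * (120 * D / n) := by gcongr
    _ = _ := by field_simp; ring

/-! ### Steklov means and Fourier coefficients of integrable periodic functions -/

/-- `f` is `2π`-periodic and integrable on bounded intervals. -/
structure PerIntegrable (f : ℝ → ℝ) : Prop where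
  periodic : Function.Periodic f (2 * Real.pi)
  intervalIntegrable : ∀ a b, IntervalIntegrable f volume a b

/-- The `k`-th Fourier coefficient of a `2π`-periodic function. -/
def fcoef (f : ℝ → ℝ) (k : ℤ) : ℂ :=
  (1 / (2 * Real.pi) : ℝ) * ∫ t in (-Real.pi)..Real.pi, (f t : ℂ) * expChar (-k) t

namespace PerIntegrable

variable {f g : ℝ → ℝ}

lemma sub (hf : PerIntegrable f) (hg : PerIntegrable g) : PerIntegrable (fun x => f x - g x) :=
  ⟨hf.periodic.sub hg.periodic, fun a b => (hf.2 a b).sub (hg.2 a b)⟩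

lemma aestronglyMeasurable (hf : PerIntegrable f) : AEStronglyMeasurable f :=
  aestronglyMeasurable_of_periodic hf.periodic
    ((intervalIntegrable_iff_integrableOn_Ioc_of_le (by linarith [Real.pi_pos])).1
      (hf.2 (-Real.pi) Real.pi)).aestronglyMeasurable

lemma aemeasurable_enorm (hf : PerIntegrable f) : AEMeasurable (fun x => ‖f x‖ₑ) :=
  hf.aestronglyMeasurable.enorm

lemma periodic_enorm (hf : PerIntegrable f) : Function.Periodic (fun x => ‖f x‖ₑ) (2 * Real.pi) :=
  fun x => by simp only [hf.periodic x]

lemma of_continuous (hf : Continuous f) (hp : Function.Periodic f (2 * Real.pi)) :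
    PerIntegrable f := ⟨hp, fun a b => hf.intervalIntegrable a b⟩

lemma steklov_eq (hf : PerIntegrable f) (v x : ℝ) :
    steklov v f x = (1 / v) * ((∫ t in (0 : ℝ)..(x + v), f t) - ∫ t in (0 : ℝ)..x, f t) := by
  rw [steklov, intervalIntegral.integral_interval_sub_left (hf.2 _ _) (hf.2 _ _)]

lemma continuous_steklov (hf : PerIntegrable f) (v : ℝ) : Continuous (steklov v f) := by
  have h := intervalIntegral.continuous_primitive hf.2 0
  have e : steklov v f = fun x =>
      (1 / v) * ((∫ t in (0 : ℝ)..(x + v), f t) - ∫ t in (0 : ℝ)..x, f t) :=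
    funext fun x => hf.steklov_eq v x
  rw [e]
  exact continuous_const.mul ((h.comp (continuous_add_const v)).sub h)

lemma steklov_comp_add (f : ℝ → ℝ) (v x : ℝ) :
    steklov v f x = (1 / v) * ∫ s in (0 : ℝ)..v, f (x + s) := by
  rw [steklov, intervalIntegral.integral_comp_add_left, add_zero]

lemma perIntegrable_steklov (hf : PerIntegrable f) (v : ℝ) : PerIntegrable (steklov v f) :=
  of_continuous (hf.continuous_steklov v) fun x => by
    simp only [steklov_comp_add, add_right_comm x, hf.periodic _]

lemma perIntegrable_steklovDiff (hf : PerIntegrable f) (v : ℝ) : PerIntegrable (steklovDiff v f) :=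
  hf.sub (hf.perIntegrable_steklov v)

lemma perIntegrable_iterate (hf : PerIntegrable f) (v : ℝ) (r : ℕ) :
    PerIntegrable ((steklovDiff v)^[r] f) := by
  induction r with
  | zero => exact hf
  | succ r ih => rw [Function.iterate_succ_apply']; exact ih.perIntegrable_steklovDiff v

lemma steklov_sub (hf : PerIntegrable f) (hg : PerIntegrable g) (v : ℝ) :
    steklov v (fun x => f x - g x) = fun x => steklov v f x - steklov v g x := by
  funext x
  simp only [steklov]
  rw [intervalIntegral.integral_sub (hf.2 _ _) (hg.2 _ _), mul_sub]

lemma iterate_sub (hf : PerIntegrable f) (hg : PerIntegrable g) (v : ℝ) (r : ℕ) :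
    (steklovDiff v)^[r] (fun x => f x - g x) =
      fun x => (steklovDiff v)^[r] f x - (steklovDiff v)^[r] g x := by
  induction r with
  | zero => rfl
  | succ r ih =>
    simp only [Function.iterate_succ_apply', ih]
    funext x
    simp only [steklovDiff,
      (hf.perIntegrable_iterate v r).steklov_sub (hg.perIntegrable_iterate v r)]
    ring

lemma continuous_sub_iterate (hf : PerIntegrable f) (v : ℝ) (r : ℕ) :
    Continuous (fun x => f x - (steklovDiff v)^[r] f x) := by
  induction r with
  | zero => simpa using continuous_const
  | succ r ih =>
    have e : (fun x => f x - (steklovDiff v)^[r + 1] f x) = fun x =>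
        (f x - (steklovDiff v)^[r] f x) + steklov v ((steklovDiff v)^[r] f) x := by
      funext x
      rw [Function.iterate_succ_apply', steklovDiff]
      ring
    rw [e]
    exact ih.add ((hf.perIntegrable_iterate v r).continuous_steklov v)

lemma intervalIntegrable_mul_expChar (hf : PerIntegrable f) (k : ℤ) (a b : ℝ) :
    IntervalIntegrable (fun t => (f t : ℂ) * expChar k t) volume a b := by
  have h : IntervalIntegrable (fun t => (f t : ℂ)) volume a b := by
    have := hf.2 a b
    rw [intervalIntegrable_iff] at this ⊢
    exact this.ofReal
  exact h.mul_continuousOn (continuous_expChar k).continuousOn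

lemma fcoef_sub (hf : PerIntegrable f) (hg : PerIntegrable g) (k : ℤ) :
    fcoef (fun x => f x - g x) k = fcoef f k - fcoef g k := by
  simp only [fcoef, Complex.ofReal_sub, sub_mul]
  rw [intervalIntegral.integral_sub (hf.intervalIntegrable_mul_expChar _ _ _)
    (hg.intervalIntegrable_mul_expChar _ _ _), mul_sub]

/-- Translating a function multiplies its Fourier coefficients by a character. -/
lemma expChar_mul_fcoef (hf : PerIntegrable f) (k : ℤ) (x : ℝ) :
    expChar k x * fcoef f k = (1 / (2 * Real.pi) : ℝ) *
      ∫ s in (-Real.pi)..Real.pi, (f (x + s) : ℂ) * expChar (-k) s := by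
  have hper : Function.Periodic (fun t => (f t : ℂ) * expChar (-k) t) (2 * Real.pi) := fun t => by
    simp only [hf.periodic t, expChar_periodic (-k) t]
  have h1 : ∀ s, (f (x + s) : ℂ) * expChar (-k) s =
      expChar k x * ((f (x + s) : ℂ) * expChar (-k) (x + s)) := fun s => by
    rw [expChar_add_arg]
    linear_combination (-((f (x + s) : ℂ) * expChar (-k) s)) * expChar_neg_mul k x
  simp_rw [h1]
  rw [intervalIntegral.integral_const_mul,
    intervalIntegral.integral_comp_add_left (fun t => (f t : ℂ) * expChar (-k) t)]
  have h2 := hper.intervalIntegral_add_eq (x + -Real.pi) (-Real.pi)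
  rw [show x + -Real.pi + 2 * Real.pi = x + Real.pi by ring,
    show -Real.pi + 2 * Real.pi = Real.pi by ring] at h2
  rw [h2, fcoef]
  ring

lemma norm_fcoef_le (f : ℝ → ℝ) (k : ℤ) :
    ‖fcoef f k‖ ≤ 1 / (2 * Real.pi) * ∫ t in (-Real.pi)..Real.pi, ‖f t‖ := by
  have hpi := Real.pi_pos
  rw [fcoef, norm_mul, Complex.norm_real, Real.norm_eq_abs, abs_of_pos (by positivity)]
  gcongr
  refine (intervalIntegral.norm_integral_le_integral_norm (by linarith)).trans (le_of_eq ?_)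
  simp only [norm_mul, norm_expChar, mul_one, Complex.norm_real]

/-- The shear `(x, s) ↦ (x + s, s)` preserves Lebesgue measure, which makes the integrand of the
double integral for the Fourier coefficients of a Steklov mean integrable. -/
lemma integrableOn_shear (hf : PerIntegrable f) (k : ℤ) {v : ℝ} (hv : 0 < v) :
    IntegrableOn (Function.uncurry fun x s : ℝ => (f (x + s) : ℂ) * expChar (-k) x)
      (uIoc (-Real.pi) Real.pi ×ˢ uIoc 0 v) := by
  have hpi := Real.pi_pos
  rw [uIoc_of_le (by linarith), uIoc_of_le hv.le]
  set F : ℝ → ℂ := (Ioc (-Real.pi) (Real.pi + v)).indicator fun t => (f t : ℂ)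
  have hF : Integrable F := by
    rw [integrable_indicator_iff measurableSet_Ioc]
    exact ((intervalIntegrable_iff_integrableOn_Ioc_of_le (by linarith)).1 (hf.2 _ _)).ofReal
  set G : ℝ → ℂ := (Ioc 0 v).indicator fun _ => 1
  have hG : Integrable G := by
    rw [integrable_indicator_iff measurableSet_Ioc]
    exact integrableOn_const (by simp)
  have h1 : Integrable (fun z : ℝ × ℝ => G z.1 * F z.2) (volume.prod volume) := hG.mul_prod hF
  have h2 : Integrable (fun z : ℝ × ℝ => G z.2 * F (z.2 + z.1)) (volume.prod volume) :=
    (((measurePreserving_prod_add (volume : Measure ℝ) volume).integrable_comp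
      h1.aestronglyMeasurable).2 h1).swap
  have h3 : Integrable (fun z : ℝ × ℝ => expChar (-k) z.1 * (G z.2 * F (z.2 + z.1)))
      (volume.prod volume) :=
    h2.bdd_mul (c := 1) ((continuous_expChar (-k)).comp continuous_fst).aestronglyMeasurable
      (Filter.Eventually.of_forall fun z => (norm_expChar _ _).le)
  refine h3.integrableOn.congr_fun (fun z hz => ?_) (measurableSet_Ioc.prod measurableSet_Ioc)
  obtain ⟨⟨a1, a2⟩, b1, b2⟩ := hz
  have e1 : G z.2 = 1 := indicator_of_mem (mem_Ioc.2 ⟨b1, b2⟩) _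
  have e2 : F (z.2 + z.1) = f (z.2 + z.1) :=
    indicator_of_mem (mem_Ioc.2 ⟨by linarith, by linarith⟩) _
  simp only [e1, e2, Function.uncurry, add_comm z.1]
  ring

lemma fcoef_steklov (hf : PerIntegrable f) {v : ℝ} (hv : 0 < v) (k : ℤ) :
    fcoef (steklov v f) k = steklovSymbol (k * v) * fcoef f k := by
  have hsymb : steklovSymbol (k * v) = (1 / v : ℝ) * ∫ s in (0 : ℝ)..v, expChar k s := by
    have h := intervalIntegral.integral_comp_mul_left (a := 0) (b := 1) (expChar k) hv.ne'
    rw [mul_zero, mul_one, Complex.real_smul] at h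
    rw [steklovSymbol, one_div, ← h]
    refine intervalIntegral.integral_congr fun s _ => ?_
    simp only [expChar]
    congr 1; push_cast; ring
  have hst : ∀ x, (steklov v f x : ℂ) * expChar (-k) x =
      (1 / v : ℝ) * ∫ s in (0 : ℝ)..v, (f (x + s) : ℂ) * expChar (-k) x := fun x => by
    rw [steklov_comp_add, Complex.ofReal_mul, ← intervalIntegral.integral_ofReal,
      intervalIntegral.integral_mul_const, mul_assoc]
  rw [fcoef]
  simp_rw [hst]
  rw [intervalIntegral.integral_const_mul,
    intervalIntegral_intervalIntegral_swap (hf.integrableOn_shear k hv), hsymb]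
  have hin : ∀ s, ∫ x in (-Real.pi)..Real.pi, (f (x + s) : ℂ) * expChar (-k) x =
      expChar k s * ∫ t in (-Real.pi)..Real.pi, (f t : ℂ) * expChar (-k) t := fun s => by
    have h := hf.expChar_mul_fcoef k s
    have hc : ((1 / (2 * Real.pi) : ℝ) : ℂ) ≠ 0 := by
      rw [Complex.ofReal_ne_zero]; have := Real.pi_pos; positivity
    rw [fcoef, mul_left_comm] at h
    simp_rw [add_comm _ s]
    exact (mul_left_cancel₀ hc h).symm
  simp_rw [hin]
  rw [intervalIntegral.integral_mul_const, fcoef]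
  ring

lemma fcoef_iterate (hf : PerIntegrable f) {v : ℝ} (hv : 0 < v) (k : ℤ) (r : ℕ) :
    fcoef ((steklovDiff v)^[r] f) k = (1 - steklovSymbol (k * v)) ^ r * fcoef f k := by
  induction r with
  | zero => simp
  | succ r ih =>
    have hr := hf.perIntegrable_iterate v r
    rw [Function.iterate_succ_apply']
    have e : steklovDiff v ((steklovDiff v)^[r] f) = fun x =>
      (steklovDiff v)^[r] f x - steklov v ((steklovDiff v)^[r] f) x := rfl
    rw [e, hr.fcoef_sub (hr.perIntegrable_steklov v), hr.fcoef_steklov hv, ih]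
    ring

/-- Pointwise Fourier inversion for a continuous function with summable coefficients. -/
lemma hasSum_fourier {w : ℝ → ℝ} (hw : Continuous w) (hp : Function.Periodic w (2 * Real.pi))
    (hs : Summable (fcoef w)) (x : ℝ) :
    HasSum (fun k => fcoef w k * expChar k x) (w x : ℂ) := by
  have : Fact (0 < 2 * Real.pi) := ⟨Real.two_pi_pos⟩
  have hpc : Function.Periodic (fun t => (w t : ℂ)) (2 * Real.pi) := fun t => by
    simp only [hp t]
  have hcont : Continuous (hpc.lift : AddCircle (2 * Real.pi) → ℂ) :=
    continuous_coinduced_dom.2 (Complex.continuous_ofReal.comp hw)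
  set W : C(AddCircle (2 * Real.pi), ℂ) := ⟨hpc.lift, hcont⟩
  have hchar : ∀ (k : ℤ) (t : ℝ), fourier k (t : AddCircle (2 * Real.pi)) = expChar k t := by
    intro k t
    rw [fourier_coe_apply, expChar]
    congr 1
    have : (Real.pi : ℂ) ≠ 0 := by exact_mod_cast Real.pi_ne_zero
    push_cast
    field_simp
  have hcoef : fourierCoeff (W : AddCircle (2 * Real.pi) → ℂ) = fcoef w := by
    funext k
    rw [fourierCoeff_eq_intervalIntegral _ k (-Real.pi), fcoef, Complex.real_smul,
      show -Real.pi + 2 * Real.pi = Real.pi by ring]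
    congr 1
    refine intervalIntegral.integral_congr fun t _ => ?_
    simp only [hchar, smul_eq_mul]
    rw [mul_comm]
    rfl
  have h := has_pointwise_sum_fourier_series_of_summable (f := W) (hcoef ▸ hs) (x : AddCircle _)
  simp only [hcoef, hchar, smul_eq_mul] at h
  exact h

end PerIntegrable

/-! ### Trigonometric polynomials -/

lemma zero_mem_trigPoly (n : ℕ) : (fun _ => 0) ∈ trigPoly n :=
  ⟨0, 0, fun x => by simp⟩

lemma add_mem_trigPoly {n : ℕ} {u v : ℝ → ℝ} (hu : u ∈ trigPoly n) (hv : v ∈ trigPoly n) :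
    (fun x => u x + v x) ∈ trigPoly n := by
  obtain ⟨a, b, hu⟩ := hu
  obtain ⟨a', b', hv⟩ := hv
  refine ⟨a + a', b + b', fun x => ?_⟩
  simp only [hu, hv]
  rw [add_add_add_comm, ← Finset.sum_add_distrib]
  simp only [Pi.add_apply]
  congr 1
  exact Finset.sum_congr rfl fun k _ => by ring

lemma re_expChar_mem_trigPoly {n : ℕ} {k : ℤ} (hk : k.natAbs ≤ n) (c : ℂ) :
    (fun x => (c * expChar k x).re) ∈ trigPoly n := by
  have hre : ∀ x : ℝ, (c * expChar k x).re =
      c.re * Real.cos (k * x) - c.im * Real.sin (k * x) := fun x => by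
    rw [Complex.mul_re, expChar, Complex.exp_ofReal_mul_I_re, Complex.exp_ofReal_mul_I_im]
  simp only [hre]
  rcases Nat.eq_zero_or_pos k.natAbs with h0 | h0
  · rw [Int.natAbs_eq_zero] at h0
    subst h0
    exact ⟨Pi.single 0 c.re, 0, fun x => by
      rw [Finset.sum_eq_zero fun j hj => ?_]
      · simp
      · have : j ≠ 0 := by have := (Finset.mem_Icc.1 hj).1; omega
        simp [Pi.single_eq_of_ne this]⟩
  · obtain ⟨s, hs⟩ : ∃ s : ℝ, ∀ x : ℝ, Real.cos (k * x) = Real.cos (k.natAbs * x) ∧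
        Real.sin (k * x) = s * Real.sin (k.natAbs * x) := by
      rcases Int.natAbs_eq k with h | h
      · refine ⟨1, fun x => ?_⟩
        have : (k : ℝ) = k.natAbs := by rw [← Int.cast_natCast, ← h]
        rw [this]; simp
      · refine ⟨-1, fun x => ?_⟩
        have : (k : ℝ) = -(k.natAbs : ℝ) := by
          rw [← Int.cast_natCast, ← Int.cast_neg, ← h]
        rw [this, neg_mul, Real.cos_neg, Real.sin_neg]; simp
    refine ⟨Pi.single k.natAbs c.re, Pi.single k.natAbs (-(c.im * s)), fun x => ?_⟩
    rw [Finset.sum_eq_single k.natAbs (fun j _ hj => by simp [Pi.single_eq_of_ne hj])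
      (fun h => (h (Finset.mem_Icc.2 ⟨h0, hk⟩)).elim), Pi.single_eq_of_ne (by omega)]
    simp only [Pi.single_eq_same, (hs x).1, (hs x).2]
    ring

lemma re_sum_expChar_mem_trigPoly {n : ℕ} (s : Finset ℤ) (hs : ∀ k ∈ s, k.natAbs ≤ n)
    (c : ℤ → ℂ) : (fun x => (∑ k ∈ s, c k * expChar k x).re) ∈ trigPoly n := by
  induction s using Finset.induction_on with
  | empty => simpa using zero_mem_trigPoly n
  | insert k s hk ih =>
    simp only [Finset.sum_insert hk, Complex.add_re]
    exact add_mem_trigPoly (re_expChar_mem_trigPoly (hs k (Finset.mem_insert_self _ _)) _)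
      (ih fun j hj => hs j (Finset.mem_insert_of_mem hj))

/-! ### Approximation of the smooth part -/

/-- The series with coefficients `ψ(k / n) ĝ(k)` is the correlation of `g` with the kernel of
`ψ`, hence is dominated by the correlation of `|g|` with the model kernel. -/
lemma enorm_tsum_symbol_le {ψ : ℝ → ℂ} (hψ : BddTwo univ (fun t => 1 / (1 + t ^ 2)) ψ) {C : ℝ}
    (hC0 : 0 ≤ C) {n : ℕ} (hn : 1 ≤ n)
    (hC : ∀ x : ℝ, |x| ≤ Real.pi → ‖symbolKernel ψ n x‖ ≤ C * kerMajorant n x)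
    {g : ℝ → ℝ} (hg : PerIntegrable g) (x : ℝ) :
    ‖∑' k : ℤ, ψ ((k : ℝ) / n) * fcoef g k * expChar k x‖ₑ ≤
      ENNReal.ofReal C * kerAvg n (fun t => ‖g t‖ₑ) x := by
  have hpi := Real.pi_pos
  set μ := (volume : Measure ℝ).restrict (Ioc (-Real.pi) Real.pi)
  have hgx : Integrable (fun s => (g (x + s) : ℂ)) μ := by
    have h1 : IntervalIntegrable (fun s => g (x + s)) volume (-Real.pi) Real.pi := by
      simpa using (hg.2 (x + -Real.pi) (x + Real.pi)).comp_add_left x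
    exact ((intervalIntegrable_iff_integrableOn_Ioc_of_le (by linarith)).1 h1).ofReal
  set F : ℤ → ℝ → ℂ := fun k s => ψ ((k : ℝ) / n) * ((g (x + s) : ℂ) * expChar (-k) s) with hF
  have hnF : ∀ k s, ‖F k s‖ = ‖ψ ((k : ℝ) / n)‖ * ‖(g (x + s) : ℂ)‖ := fun k s => by
    simp only [hF, norm_mul, norm_expChar, mul_one]
  have hFi : ∀ k, Integrable (F k) μ := fun k =>
    (hgx.mul_bdd (c := 1) (continuous_expChar (-k)).aestronglyMeasurable
      (Filter.Eventually.of_forall fun s => (norm_expChar _ s).le)).const_mul _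
  have hFs : Summable fun k => ∫ s, ‖F k s‖ ∂μ := by
    simp_rw [hnF, integral_const_mul]
    exact (summable_norm_symbol hψ hn).mul_right _
  have hsum := hasSum_integral_of_summable_integral_norm hFi hFs
  have hterm : ∀ k : ℤ, ψ ((k : ℝ) / n) * fcoef g k * expChar k x =
      (1 / (2 * Real.pi) : ℝ) * ∫ s, F k s ∂μ := fun k => by
    have h := hg.expChar_mul_fcoef k x
    rw [intervalIntegral.integral_of_le (by linarith)] at h
    rw [mul_assoc, mul_comm (fcoef g k), h, integral_const_mul]
    ring
  have hker : ∀ s, ∑' k, F k s = (g (x + s) : ℂ) * symbolKernel ψ n (-s) := fun s => by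
    rw [symbolKernel, ← tsum_mul_left]
    exact tsum_congr fun k => by rw [expChar_neg_arg]; ring
  have hscale : ‖((1 / (2 * Real.pi) : ℝ) : ℂ)‖ₑ ≤ 1 := by
    rw [← ofReal_norm, Complex.norm_real, Real.norm_eq_abs,
      abs_of_pos (by positivity), ENNReal.ofReal_le_one, div_le_one (by positivity)]
    linarith [Real.pi_gt_three]
  have hkm : Measurable (fun t => ENNReal.ofReal (kerMajorant n t)) := by
    unfold kerMajorant; fun_prop
  simp_rw [hterm]
  rw [tsum_mul_left, hsum.tsum_eq, enorm_mul]
  calc ‖((1 / (2 * Real.pi) : ℝ) : ℂ)‖ₑ * ‖∫ s, ∑' k, F k s ∂μ‖ₑ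
      ≤ 1 * ∫⁻ s, ‖∑' k, F k s‖ₑ ∂μ := by
        gcongr
        exact enorm_integral_le_lintegral_enorm _
    _ ≤ ∫⁻ s, ENNReal.ofReal C * (ENNReal.ofReal (kerMajorant n s) * ‖g (x + s)‖ₑ) ∂μ := by
        rw [one_mul]
        refine setLIntegral_mono' measurableSet_Ioc fun s hs => ?_
        have hle := hC (-s) (by rw [abs_neg]; exact abs_le.2 ⟨hs.1.le, hs.2⟩)
        have heven : kerMajorant n (-s) = kerMajorant n s := by simp [kerMajorant]
        rw [hker, enorm_mul, mul_comm, ← mul_assoc, ← ENNReal.ofReal_mul hC0, ← heven,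
          ← ofReal_norm (symbolKernel ψ n (-s))]
        gcongr
        rw [← ofReal_norm, ← ofReal_norm, Complex.norm_real]
    _ = _ := lintegral_const_mul' _ _ ENNReal.ofReal_ne_top

/-- The smooth part `(I - (I - 𝔗_v)^r)² f`, `v = 1 / n`, is approximated by its smoothly truncated
Fourier series; the error is the image of `(I - 𝔗_v)^r f` under the Jackson symbol. -/
lemma exists_trigPoly_smooth_part (r : ℕ) {C : ℝ} (hC0 : 0 ≤ C) {n : ℕ} (hn : 1 ≤ n)
    (hC : ∀ x : ℝ, |x| ≤ Real.pi → ‖symbolKernel (jacksonSymbol r) n x‖ ≤ C * kerMajorant n x)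
    {f h w : ℝ → ℝ} (hf : PerIntegrable f)
    (hh : h = fun x => f x - (steklovDiff (1 / n))^[r] f x)
    (hw : w = fun x => h x - (steklovDiff (1 / n))^[r] h x) :
    ∃ u ∈ trigPoly n, ∀ x, ‖w x - u x‖ₑ ≤
      ENNReal.ofReal C * kerAvg n (fun t => ‖(steklovDiff (1 / n))^[r] f t‖ₑ) x := by
  have hn0 : (0 : ℝ) < n := by exact_mod_cast hn
  have hv : (0 : ℝ) < 1 / n := by positivity
  set g := (steklovDiff (1 / n))^[r] f with hgdef
  have hg : PerIntegrable g := hf.perIntegrable_iterate _ r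
  have hhp : PerIntegrable h := hh ▸ hf.sub hg
  have hwp : PerIntegrable w := hw ▸ hhp.sub (hhp.perIntegrable_iterate _ r)
  have hwc : Continuous w := hw ▸ hhp.continuous_sub_iterate _ r
  set η : ℤ → ℂ := fun k => ((cutoff ((k : ℝ) / n) : ℝ) : ℂ)
  have hη : ∀ k ∉ Finset.Icc (-n : ℤ) n, η k = 0 := by
    intro k hk
    have : (n : ℝ) ≤ |(k : ℝ)| := by
      rw [Finset.mem_Icc, not_and_or, not_le, not_le] at hk
      rw [le_abs]
      rcases hk with hk | hk
      · right
        have : (k : ℝ) < -n := by exact_mod_cast hk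
        linarith
      · left
        have : (n : ℝ) < k := by exact_mod_cast hk
        linarith
    simp only [η]
    rw [cutoff_eq_zero (by rwa [abs_div, Nat.abs_cast, one_le_div hn0]), Complex.ofReal_zero]
  have hcoef : ∀ k, fcoef w k =
      η k * fcoef w k + jacksonSymbol r ((k : ℝ) / n) * fcoef g k := by
    intro k
    have e := jacksonSymbol_mul r ((k : ℝ) / n)
    have hcg : fcoef g k = (1 - steklovSymbol ((k : ℝ) / n)) ^ r * fcoef f k := by
      rw [hgdef, hf.fcoef_iterate hv, mul_one_div]
    have hcw : fcoef w k = (1 - (1 - steklovSymbol ((k : ℝ) / n)) ^ r) ^ 2 * fcoef f k := by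
      rw [hw, hhp.fcoef_sub (hhp.perIntegrable_iterate _ r), hhp.fcoef_iterate hv, hh,
        hf.fcoef_sub hg, hcg, mul_one_div]
      ring
    rw [hcg, hcw, ← mul_assoc (jacksonSymbol r _), e]
    simp only [η]
    ring
  have s1 : Summable fun k => η k * fcoef w k := by
    refine summable_of_ne_finset_zero (s := Finset.Icc (-n : ℤ) n) fun k hk => ?_
    rw [hη k hk, zero_mul]
  have hψ := bddTwo_jacksonSymbol r
  have s2 : Summable fun k : ℤ => ‖jacksonSymbol r ((k : ℝ) / n) * fcoef g k‖ := by
    refine Summable.of_nonneg_of_le (fun _ => norm_nonneg _) (fun k => ?_)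
      ((summable_norm_symbol hψ hn).mul_right
        (1 / (2 * Real.pi) * ∫ t in (-Real.pi)..Real.pi, ‖g t‖))
    rw [norm_mul]
    gcongr
    exact PerIntegrable.norm_fcoef_le g k
  have hsw : Summable (fcoef w) := (s1.add s2.of_norm).congr fun k => (hcoef k).symm
  refine ⟨fun x => (∑ k ∈ Finset.Icc (-n : ℤ) n, (η k * fcoef w k) * expChar k x).re,
    re_sum_expChar_mem_trigPoly _ (fun k hk => ?_) _, fun x => ?_⟩
  · have := Finset.mem_Icc.1 hk
    omega
  · have hinv := PerIntegrable.hasSum_fourier hwc hwp.periodic hsw x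
    have t1 : HasSum (fun k => (η k * fcoef w k) * expChar k x)
        (∑ k ∈ Finset.Icc (-n : ℤ) n, (η k * fcoef w k) * expChar k x) :=
      hasSum_sum_of_ne_finset_zero fun k hk => by rw [hη k hk, zero_mul, zero_mul]
    have t2 : HasSum (fun k : ℤ => jacksonSymbol r ((k : ℝ) / n) * fcoef g k * expChar k x)
        (w x - ∑ k ∈ Finset.Icc (-n : ℤ) n, (η k * fcoef w k) * expChar k x) :=
      (hinv.sub t1).congr_fun fun k => by
        linear_combination (-expChar k x) * hcoef k
    have hre : w x - (∑ k ∈ Finset.Icc (-n : ℤ) n, (η k * fcoef w k) * expChar k x).re =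
        ((w x : ℂ) - ∑ k ∈ Finset.Icc (-n : ℤ) n, (η k * fcoef w k) * expChar k x).re := by
      simp
    rw [hre]
    refine le_trans ?_ (enorm_tsum_symbol_le hψ hC0 hn hC hg x)
    rw [t2.tsum_eq, ← ofReal_norm, ← ofReal_norm]
    exact ENNReal.ofReal_le_ofReal (Complex.abs_re_le_norm _)

/-! ### Norm estimates -/

/-- The bound for local averages at the largest scale `π` contains the embedding of the weighted
space into the integrable functions. -/
lemma perIntegrable_of_memWLp {p : ℝ≥0∞} (hp : 1 ≤ p) {γ : ℝ → ℝ≥0∞} (hγ : IsWeight γ) {C : ℝ≥0}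
    (hC : AvgBounded p γ C) {f : ℝ → ℝ} (hf : MemWLp p γ f) : PerIntegrable f := by
  have hpi := Real.pi_pos
  have hm : AEStronglyMeasurable f := aestronglyMeasurable_of_periodic hf.periodic
    (hf.memLp.1.mono_ac hγ.restrict_absolutelyContinuous)
  have hFp : Function.Periodic (fun x => ‖f x‖ₑ) (2 * Real.pi) := fun x => by
    simp only [hf.periodic x]
  have hb := hC (fun x => ‖f x‖ₑ) hm.enorm hFp Real.pi hpi le_rfl
  have hfin : eLpNorm (locAvg Real.pi fun x => ‖f x‖ₑ) p (weightMeasure γ) < ∞ := by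
    refine hb.trans_lt (ENNReal.mul_lt_top ENNReal.coe_lt_top ?_)
    rw [eLpNorm_enorm]
    exact hf.memLp.2
  set I := ∫⁻ x in Ioc (-Real.pi) Real.pi, ‖f x‖ₑ with hI
  -- At the scale `π` the local average is the mean over a whole period, a constant.
  have hconst : (locAvg Real.pi fun x => ‖f x‖ₑ) = fun _ => I / ENNReal.ofReal Real.pi := by
    funext x
    rw [locAvg_eq, hI, Ioc_neg_pi_pi, setLIntegral_period_eq hFp (-Real.pi) (x - Real.pi)]
    congr 4; ring
  have hμ : weightMeasure γ ≠ 0 := by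
    intro h0
    have := hγ.restrict_absolutelyContinuous (s := univ) (by rw [h0]; simp)
    simp at this
    linarith
  have hIt : I < ∞ := by
    by_contra hcon
    rw [hconst, not_lt_top_iff.1 hcon, ENNReal.top_div_of_ne_top ENNReal.ofReal_ne_top] at hfin
    rcases eq_or_ne p ∞ with rfl | hpt
    · rw [eLpNorm_exponent_top, eLpNormEssSup_const _ hμ] at hfin
      simp at hfin
    · rw [eLpNorm_const' _ (by positivity) hpt] at hfin
      have : (weightMeasure γ) univ ^ (1 / p.toReal) ≠ 0 := by
        simp [ENNReal.rpow_eq_zero_iff, hμ]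
      rw [enorm_eq_self, ENNReal.top_mul this] at hfin
      exact hfin.ne rfl
  refine ⟨hf.periodic, fun a b => hf.periodic.intervalIntegrable (t := -Real.pi)
    Real.two_pi_pos.ne' ?_ a b⟩
  rw [intervalIntegrable_iff_integrableOn_Ioc_of_le (by linarith), ← Ioc_neg_pi_pi]
  exact ⟨hm.restrict, hIt⟩

lemma wNorm_steklovDiff_le {p : ℝ≥0∞} (hp : 1 ≤ p) {γ : ℝ → ℝ≥0∞} {C : ℝ≥0}
    (hC : AvgBounded p γ C) {f : ℝ → ℝ} (hf : PerIntegrable f) {v : ℝ} (hv : 0 < v)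
    (hπ : v ≤ Real.pi) :
    wNorm p γ (steklovDiff v f) ≤ (1 + C) * wNorm p γ f := by
  have hac : weightMeasure γ ≪ volume :=
    (withDensity_absolutelyContinuous _ _).trans Measure.restrict_le_self.absolutelyContinuous
  have hst : eLpNorm (steklov v f) p (weightMeasure γ) ≤ C * wNorm p γ f := by
    have h := hC (fun x => ‖f x‖ₑ) hf.aemeasurable_enorm hf.periodic_enorm v hv hπ
    rw [eLpNorm_enorm] at h
    refine le_trans (eLpNorm_mono_enorm_ae (Filter.Eventually.of_forall fun x => ?_)) h
    rw [enorm_eq_self, PerIntegrable.steklov_comp_add, enorm_mul, locAvg,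
      ENNReal.div_eq_inv_mul]
    refine mul_le_mul' (le_of_eq ?_) ?_
    · rw [← ENNReal.ofReal_inv_of_pos hv, one_div, Real.enorm_eq_ofReal (by positivity)]
    · rw [intervalIntegral.integral_of_le hv.le]
      exact (enorm_integral_le_lintegral_enorm _).trans
        (lintegral_mono_set (Ioc_subset_Ioc_left (by linarith)))
  rw [add_mul, one_mul]
  exact (eLpNorm_sub_le (hf.aestronglyMeasurable.mono_ac hac)
    (hf.continuous_steklov v).aestronglyMeasurable hp).trans (add_le_add le_rfl hst)

lemma wNorm_iterate_le {p : ℝ≥0∞} (hp : 1 ≤ p) {γ : ℝ → ℝ≥0∞} {C : ℝ≥0}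
    (hC : AvgBounded p γ C) {f : ℝ → ℝ} (hf : PerIntegrable f) {v : ℝ} (hv : 0 < v)
    (hπ : v ≤ Real.pi) (r : ℕ) :
    wNorm p γ ((steklovDiff v)^[r] f) ≤ (1 + C) ^ r * wNorm p γ f := by
  induction r with
  | zero => simp
  | succ r ih =>
    rw [Function.iterate_succ_apply', pow_succ', mul_assoc]
    exact (wNorm_steklovDiff_le hp hC (hf.perIntegrable_iterate v r) hv hπ).trans (by gcongr)

/-- The Jackson inequality, with a constant built from a bound for the local averages and from
the kernel bound for the Jackson symbol. -/
lemma bestApprox_le {p : ℝ≥0∞} (hp : 1 ≤ p) (r : ℕ) {γ : ℝ → ℝ≥0∞} (hγ : IsWeight γ) {C : ℝ≥0}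
    (hC : AvgBounded p γ C) {f : ℝ → ℝ} (hf : MemWLp p γ f) {n : ℕ} (hn : 1 ≤ n) {D : ℝ}
    (hD0 : 0 ≤ D)
    (hD : ∀ x : ℝ, |x| ≤ Real.pi → ‖symbolKernel (jacksonSymbol r) n x‖ ≤ D * kerMajorant n x) :
    bestApprox n f p γ ≤ (D.toNNReal * (8 * C) + (2 + (1 + C) ^ r) : ℝ≥0) *
      modulus r f (1 / n) p γ := by
  have hfp := perIntegrable_of_memWLp hp hγ hC hf
  have hn0 : (0 : ℝ) < n := by exact_mod_cast hn
  have hv : (0 : ℝ) < 1 / n := by positivity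
  have hvπ : (1 : ℝ) / n ≤ Real.pi := by
    have h1 : (1 : ℝ) / n ≤ 1 := by rw [div_le_one hn0]; exact_mod_cast hn
    linarith [Real.pi_gt_three]
  have hac : weightMeasure γ ≪ volume :=
    (withDensity_absolutelyContinuous _ _).trans Measure.restrict_le_self.absolutelyContinuous
  set S := steklovDiff (1 / (n : ℝ))
  set g := S^[r] f with hg
  have hgp : PerIntegrable g := hfp.perIntegrable_iterate _ r
  set h : ℝ → ℝ := fun x => f x - S^[r] f x with hh
  have hhp : PerIntegrable h := hfp.sub hgp
  set w : ℝ → ℝ := fun x => h x - S^[r] h x with hw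
  have hwp : PerIntegrable w := hhp.sub (hhp.perIntegrable_iterate _ r)
  obtain ⟨u, hu, hwu⟩ := exists_trigPoly_smooth_part r hD0 hn hD hfp hh hw
  have huc : Continuous u := by
    obtain ⟨a, b, hab⟩ := hu
    have : u = _ := funext hab
    rw [this]
    fun_prop
  have hgm := hgp.aestronglyMeasurable.mono_ac hac
  have hSgm := (hgp.perIntegrable_iterate (1 / n) r).aestronglyMeasurable.mono_ac hac
  -- `f - (I - S^r)² f = 2 S^r f - S^{2r} f` involves `f` only through `S^r f`.
  have hsplit : (fun x => f x - u x) = (fun x => w x - u x) + ((g + g) - S^[r] g) := by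
    funext x
    have e : S^[r] h = fun x => S^[r] f x - S^[r] g x := hfp.iterate_sub hgp _ r
    simp only [hw, hh, Pi.add_apply, Pi.sub_apply]
    rw [e]
    simp only [hg]
    ring
  have hker : wNorm p γ (fun x => w x - u x) ≤ D.toNNReal * (8 * C * wNorm p γ g) := by
    refine (eLpNorm_le_mul_eLpNorm_of_ae_le_mul' (c := D.toNNReal)
      (g := kerAvg n (fun t => ‖g t‖ₑ)) (Filter.Eventually.of_forall hwu) p).trans ?_
    gcongr
    refine (eLpNorm_kerAvg_le hp hC hn hgp.aemeasurable_enorm hgp.periodic_enorm).trans ?_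
    rw [eLpNorm_enorm, wNorm]
  have hrest : wNorm p γ ((g + g) - S^[r] g) ≤ (2 + (1 + C) ^ r) * wNorm p γ g := by
    refine (eLpNorm_sub_le (hgm.add hgm) hSgm hp).trans ?_
    rw [add_mul, two_mul]
    exact add_le_add (eLpNorm_add_le hgm hgm hp) (wNorm_iterate_le hp hC hgp hv hvπ r)
  calc bestApprox n f p γ ≤ wNorm p γ (fun x => f x - u x) := iInf₂_le u hu
    _ ≤ wNorm p γ (fun x => w x - u x) + wNorm p γ ((g + g) - S^[r] g) := by
        rw [hsplit]
        exact eLpNorm_add_le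
          ((hwp.aestronglyMeasurable.mono_ac hac).sub huc.aestronglyMeasurable)
          ((hgm.add hgm).sub hSgm) hp
    _ ≤ D.toNNReal * (8 * C * wNorm p γ g) + (2 + (1 + C) ^ r) * wNorm p γ g :=
        add_le_add hker hrest
    _ = _ := by
        rw [modulus, ← hg]
        push_cast
        ring

end WeightedJackson

end

theorem mainTheorem4 (p : ℝ≥0∞) (hp : 1 ≤ p) (r : ℕ) (hr : 1 ≤ r)
    (K c : ℝ≥0) (hc : 0 < c) :
    ∃ C : ℝ≥0, 0 < C ∧ ∀ γ : ℝ → ℝ≥0∞, WeightedJackson.ASClass p γ →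
      WeightedJackson.weightConst p γ ≤ (K : ℝ≥0∞) →
      (p = 1 → ∀ᵐ x : ℝ, (c : ℝ≥0∞) ≤ γ x) →
      ∀ f : ℝ → ℝ, WeightedJackson.MemWLp p γ f →
      ∀ n : ℕ, 1 ≤ n →
        WeightedJackson.bestApprox n f p γ ≤
          (C : ℝ≥0∞) * WeightedJackson.modulus r f (1 / (n : ℝ)) p γ := by
  obtain ⟨B, hB⟩ := WeightedJackson.exists_avgBounded hp K c hc
  obtain ⟨D, hD0, hD⟩ :=
    WeightedJackson.exists_norm_symbolKernel_le (WeightedJackson.bddTwo_jacksonSymbol r)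
  exact ⟨D.toNNReal * (8 * B) + (2 + (1 + B) ^ r), by positivity, fun γ hγ hK hcγ f hf n hn =>
    WeightedJackson.bestApprox_le hp r hγ.weight (hB γ hγ hK hcγ) hf hn hD0 (hD n hn)⟩
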